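/- Words are elements of the free semigroup $\mathfrak A^+$ over a countably infinite alphabet $\mathfrak A$ of variables. An identity $\mathbf u\approx\mathbf v$ is a pair of words; a semigroup $S$ satisfies it if $\varphi(\mathbf u)=\varphi(\mathbf v)$ for every homomorphism $\varphi:\mathfrak A^+\to S$. An identity can be deduced from a set $\Sigma$ of identities if it lies in the congruence on $\mathfrak A^+$ generated by all pairs $(\theta(\mathbf p),\theta(\mathbf q))$ with $(\mathbf p\approx\mathbf q)\in\Sigma$ and $\theta$ an endomorphism of $\mathfrak A^+$. A semigroup is finitely based if all of its identities can be deduced from some finite subset of them, and non-finitely based otherwise. For a set $W$ of words in the free monoid $\mathfrak A^*$, let $S(W)$ be the Rees quotient of $\mathfrak A^*$ over the ideal of all words that are not subwords (contiguous factors) of words in $W$. Let $S_4$ be the monoid, under composition, of all reflexive binary relations on a set with four elements, and let $a,t_1,t_2$ be three distinct letters of $\mathfrak A$. Then the direct product $S_4\times S(\{at_1at_2a\})$ is non-finitely based, while both $S_4$ and $S(\{at_1at_2a\})$ are finitely based. -/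

import Mathlib

/-- Words: elements of the free semigroup over a countably infinite alphabet of variables. -/
abbrev Word : Type := FreeSemigroup ℕ

/-- The semigroup `S` satisfies the identity `u ≈ v`: both sides have the same value
under every substitution of elements of `S` for the variables. -/
def SatisfiesIdentity (S : Type*) [Semigroup S] (u v : Word) : Prop :=
  ∀ φ : Word →ₙ* S, φ u = φ v

/-- The set of all identities `u ≈ v` (encoded as pairs) satisfied by the semigroup `S`. -/
def identitiesOf (S : Type*) [Semigroup S] : Set (Word × Word) :=
  {p | SatisfiesIdentity S p.1 p.2}

/-- The identity `u ≈ v` can be deduced from the set of identities `E`: the pair `(u, v)` lies in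
the congruence on the free semigroup generated by all pairs `(θ p, θ q)`, where `p ≈ q` is
in `E` and `θ` is a substitution, i.e. an endomorphism of the free semigroup. -/
def Deducible (E : Set (Word × Word)) (u v : Word) : Prop :=
  conGen (fun x y : Word ↦ ∃ p ∈ E, ∃ θ : Word →ₙ* Word, x = θ p.1 ∧ y = θ p.2) u v

/-- A semigroup is finitely based if all of its identities can be deduced from
a finite subset of them. -/
def FinitelyBased (S : Type*) [Semigroup S] : Prop :=
  ∃ E : Set (Word × Word), E.Finite ∧ E ⊆ identitiesOf S ∧
    ∀ p ∈ identitiesOf S, Deducible E p.1 p.2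

/-- The reflexive binary relations on `X`. -/
def ReflRel (X : Type*) : Type _ := {R : SetRel X X // R.IsRefl}

/-- Reflexive relations form a monoid under composition of relations: the product of `R` and `T`
relates `a` to `c` iff `a R b` and `b T c` for some `b`, and the unit is equality. -/
instance (X : Type*) : Monoid (ReflRel X) where
  mul R T := ⟨R.1.comp T.1, haveI := R.2; haveI := T.2; inferInstance⟩
  one := ⟨SetRel.id, SetRel.id_subset_iff.1 subset_rfl⟩
  mul_assoc R T U := Subtype.ext (SetRel.comp_assoc R.1 T.1 U.1)
  one_mul R := Subtype.ext (SetRel.id_comp R.1)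
  mul_one R := Subtype.ext (SetRel.comp_id R.1)

/-- `u` is a subword (a contiguous factor, possibly empty) of some word of `W`. -/
def IsSubwordOf {A : Type*} (W : Set (FreeMonoid A)) (u : FreeMonoid A) : Prop :=
  ∃ w ∈ W, ∃ p q : FreeMonoid A, w = p * u * q

theorem IsSubwordOf.left {A : Type*} {W : Set (FreeMonoid A)} {u v : FreeMonoid A}
    (h : IsSubwordOf W (u * v)) : IsSubwordOf W u := by
  obtain ⟨w, hw, p, q, rfl⟩ := h
  exact ⟨_, hw, p, v * q, by simp only [mul_assoc]⟩

theorem IsSubwordOf.right {A : Type*} {W : Set (FreeMonoid A)} {u v : FreeMonoid A}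
    (h : IsSubwordOf W (u * v)) : IsSubwordOf W v := by
  obtain ⟨w, hw, p, q, rfl⟩ := h
  exact ⟨_, hw, p * u, q, by simp only [mul_assoc]⟩

/-- The Rees congruence on the free monoid modulo the ideal of all words that are not subwords
of words in `W`: it collapses this ideal to one class and is equality elsewhere. -/
def dilworthCon {A : Type*} (W : Set (FreeMonoid A)) : Con (FreeMonoid A) where
  r u v := u = v ∨ (¬ IsSubwordOf W u ∧ ¬ IsSubwordOf W v)
  iseqv :=
    { refl := fun _ ↦ Or.inl rfl
      symm := by
        rintro u v (rfl | ⟨h1, h2⟩)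
        · exact Or.inl rfl
        · exact Or.inr ⟨h2, h1⟩
      trans := by
        rintro u v w (rfl | ⟨h1, h2⟩) (rfl | ⟨h3, h4⟩)
        · exact Or.inl rfl
        · exact Or.inr ⟨h3, h4⟩
        · exact Or.inr ⟨h1, h2⟩
        · exact Or.inr ⟨h1, h4⟩ }
  mul' := by
    rintro u v x y (rfl | ⟨h1, h2⟩) (rfl | ⟨h3, h4⟩)
    · exact Or.inl rfl
    · exact Or.inr ⟨fun h ↦ h3 h.right, fun h ↦ h4 h.right⟩
    · exact Or.inr ⟨fun h ↦ h1 h.left, fun h ↦ h2 h.left⟩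
    · exact Or.inr ⟨fun h ↦ h1 h.left, fun h ↦ h2 h.left⟩

/-- The monoid `S(W)`: the Rees quotient of the free monoid over the ideal of all words that are
not subwords of words in `W`. -/
abbrev DilworthMonoid {A : Type*} (W : Set (FreeMonoid A)) : Type _ := (dilworthCon W).Quotient

/-!
An identity is handled as a pair of lists of variables, and for a monoid variables may take the
value `1`. Writing `SubEquiv k u v` for "`u` and `v` have the same subsequences of length at most
`k`", the theorem rests on descriptions of the identities of the two factors.

*Reflexive relations.* A product of reflexive relations on `k + 1` points is determined by its
subproducts with at most `k` factors, since factors that do not enlarge the set of points reached so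
far can be dropped (`RelatedBy.exists_short`); conversely a chain of `k + 1` points detects every
subsequence of length `k`. So `S₄` satisfies `u ≈ v` iff `SubEquiv 3 u v`
(`listIdentity_reflRel_iff`). By Simon's interpolation argument
(`SubEquiv.insert_or_insert`, `IsListCon.of_subEquiv`), equivalent words are connected by insertions
and deletions of single letters within the class. Inserting `x` between `p` and `q` preserves the
class only if `p` absorbs `x` on the right to depth `i` and `q` absorbs it on the left to depth `j`
for some `i + j = 3`. In each of the cases the insertion follows from a few fixed identities
(`subThree_complete`): if `x` occurs in `p`, it travels letter by letter to its next occurrence,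
and if `q` does all the absorbing, a prefix of `q` can be cubed first.

*The monoid of factors of `a t₁ a t₂ a`.* A substitution with nonzero value maps at most one
repeated variable to a nonempty word, and this word is `a`. Hence only the repeated variables with
two or three occurrences, all of them separated by variables occurring once (`Spread`), carry
information: their positions relative to the variables occurring once
(`PatternIdentity.restrict_eq_of_spread`). All other repeated variables `x` can be collected to `x²`
at the front (`pattern_collect`), and adjacent repeated variables commute (`pattern_sort`). This
gives a finite basis (`pattern_complete`).

*The product.* The word `x t y₁ ⋯ yₖ x yₖ ⋯ y₁ x` may be changed to `x t x y₁ ⋯ yₖ x yₖ ⋯ y₁ x`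
under the identities of both factors. It is determined by its subsequences of length at most three
and the number of its letters `x` (`eq_mirrorWord`). An identity of the product that changes this
number has to change the number of occurrences of a variable `z` with value `x`. This variable
occurs three times, and a variable with `t` in its value separates its first two occurrences. If the
identity has fewer than `k` letters, some variable between the last two occurrences has two adjacent
letters of `yₖ ⋯ y₁` in its value, so that it occurs only once. Then `z` is spread, and the second
factor does not allow its number of occurrences to change (`count_eq_of_instance`). So no finite set
of identities of the product suffices.
-/

/-! ### Identities as pairs of lists of letters -/

/-- The nonempty list of letters of a word. -/
def letters (w : Word) : List ℕ := w.head :: w.tail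

theorem letters_mul (u v : Word) : letters (u * v) = letters u ++ letters v := rfl

theorem letters_injective : Function.Injective letters := by
  rintro ⟨a, l⟩ ⟨b, m⟩ h
  simp only [letters, List.cons.injEq] at h
  simp [h.1, h.2]

theorem exists_letters_eq {l : List ℕ} (h : l ≠ []) : ∃ w : Word, letters w = l := by
  cases l with
  | nil => exact absurd rfl h
  | cons a l => exact ⟨⟨a, l⟩, rfl⟩

/-- The identity `u ≈ v` of monoids: the sides are possibly empty lists of variables, and
variables may take the value `1`. -/
def ListIdentity (M : Type*) [Monoid M] (u v : List ℕ) : Prop :=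
  ∀ f : ℕ → M, (u.map f).prod = (v.map f).prod

theorem map_eq_prod_letters {M : Type*} [Monoid M] (φ : Word →ₙ* M) (w : Word) :
    φ w = ((letters w).map fun x ↦ φ (FreeSemigroup.of x)).prod := by
  induction w using FreeSemigroup.recOnMul with
  | ih1 x => simp [letters, FreeSemigroup.of]
  | ih2 x y _ ihy =>
    rename_i ihx
    rw [map_mul, letters_mul, List.map_append, List.prod_append, ← ihx, ← ihy]

theorem letters_map (θ : Word →ₙ* Word) (w : Word) :
    letters (θ w) = (letters w).flatMap fun x ↦ letters (θ (FreeSemigroup.of x)) := by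
  induction w using FreeSemigroup.recOnMul with
  | ih1 x => simp [letters, FreeSemigroup.of]
  | ih2 x y _ ihy =>
    rename_i ihx
    rw [map_mul, letters_mul, letters_mul, List.flatMap_append, ← ihx, ← ihy]

theorem satisfiesIdentity_iff {M : Type*} [Monoid M] {u v : Word} :
    SatisfiesIdentity M u v ↔ ListIdentity M (letters u) (letters v) := by
  constructor
  · intro h f
    have := h (FreeSemigroup.lift f)
    simpa [map_eq_prod_letters] using this
  · intro h φ
    rw [map_eq_prod_letters, map_eq_prod_letters]
    exact h _

namespace ListIdentity

variable {M : Type*} [Monoid M] {u v : List ℕ}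

theorem symm (h : ListIdentity M u v) : ListIdentity M v u := fun f ↦ (h f).symm

theorem append (h : ListIdentity M u v) (p q : List ℕ) :
    ListIdentity M (p ++ u ++ q) (p ++ v ++ q) := fun f ↦ by
  simp [h f]

theorem flatMap (h : ListIdentity M u v) (θ : ℕ → List ℕ) :
    ListIdentity M (u.flatMap θ) (v.flatMap θ) := fun f ↦ by
  have key : ∀ w : List ℕ, ((w.flatMap θ).map f).prod
      = (w.map fun x ↦ ((θ x).map f).prod).prod := fun w ↦ by
    induction w with
    | nil => rfl
    | cons a w ih => simp [ih]
  rw [key, key, h]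

theorem filter (h : ListIdentity M u v) (P : ℕ → Bool) :
    ListIdentity M (u.filter P) (v.filter P) := by
  have key : ∀ w : List ℕ, w.filter P = w.flatMap fun x ↦ if P x then [x] else [] := fun w ↦ by
    induction w with
    | nil => rfl
    | cons a w ih => by_cases ha : P a <;> simp [ha, ih]
  rw [key, key]
  exact h.flatMap _

end ListIdentity

/-- A congruence of the free monoid, written with lists. -/
structure IsListCon (R : List ℕ → List ℕ → Prop) : Prop where
  refl : ∀ u, R u u
  symm : ∀ {u v}, R u v → R v u
  trans : ∀ {u v w}, R u v → R v w → R u w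
  append : ∀ {u v} (p q : List ℕ), R u v → R (p ++ u ++ q) (p ++ v ++ q)

theorem IsListCon.append_left {R : List ℕ → List ℕ → Prop} (hR : IsListCon R) {u v : List ℕ}
    (p : List ℕ) (h : R u v) : R (p ++ u) (p ++ v) := by
  simpa using hR.append p [] h

theorem IsListCon.append_right {R : List ℕ → List ℕ → Prop} (hR : IsListCon R) {u v : List ℕ}
    (q : List ℕ) (h : R u v) : R (u ++ q) (v ++ q) := by
  simpa using hR.append [] q h

/-- The relation `R` contains all instances of the identities in `rules`, where variables may be
replaced by the empty list. -/
def ContainsInstances (R : List ℕ → List ℕ → Prop) (rules : List (List ℕ × List ℕ)) : Prop :=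
  ∀ r ∈ rules, ∀ θ : ℕ → List ℕ, R (r.1.flatMap θ) (r.2.flatMap θ)

/-- The relation on possibly empty lists given by deducibility from `E`. -/
def ListDeducible (E : Set (Word × Word)) (u v : List ℕ) : Prop :=
  u = v ∨ ∃ U V : Word, letters U = u ∧ letters V = v ∧ Deducible E U V

theorem isListCon_listDeducible (E : Set (Word × Word)) : IsListCon (ListDeducible E) where
  refl _ := Or.inl rfl
  symm := by
    rintro u v (rfl | ⟨U, V, rfl, rfl, h⟩)
    · exact Or.inl rfl
    · exact Or.inr ⟨V, U, rfl, rfl, Con.symm _ h⟩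
  trans := by
    rintro u v w (rfl | ⟨U, V, rfl, rfl, h⟩) (rfl | ⟨V', W, hV, rfl, h'⟩)
    · exact Or.inl rfl
    · exact Or.inr ⟨V', W, hV, rfl, h'⟩
    · exact Or.inr ⟨U, V, rfl, rfl, h⟩
    · obtain rfl := letters_injective hV
      exact Or.inr ⟨U, W, rfl, rfl, Con.trans _ h h'⟩
  append := by
    rintro u v p q (rfl | ⟨U, V, rfl, rfl, h⟩)
    · exact Or.inl rfl
    · have left : ∃ U' V' : Word, letters U' = p ++ letters U ∧ letters V' = p ++ letters V ∧
          Deducible E U' V' := by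
        by_cases hp : p = []
        · exact ⟨U, V, by simp [hp], by simp [hp], h⟩
        · obtain ⟨P, rfl⟩ := exists_letters_eq hp
          exact ⟨P * U, P * V, rfl, rfl, Con.mul _ (Con.refl _ P) h⟩
      obtain ⟨U', V', hU, hV, h⟩ := left
      rw [← hU, ← hV]
      by_cases hq : q = []
      · exact Or.inr ⟨U', V', by simp [hq], by simp [hq], h⟩
      · obtain ⟨Q, rfl⟩ := exists_letters_eq hq
        exact Or.inr ⟨U' * Q, V' * Q, rfl, rfl, Con.mul _ h (Con.refl _ Q)⟩

theorem flatMap_filter_ne_nil (θ : ℕ → List ℕ) (u : List ℕ) :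
    (u.filter fun x ↦ θ x ≠ []).flatMap θ = u.flatMap θ := by
  induction u with
  | nil => rfl
  | cons a u ih => by_cases ha : θ a = [] <;> simp_all

/-- A monoid is finitely based as a semigroup once its monoid identities follow from finitely many.
The finite basis consists of the given identities with any set of variables erased. -/
theorem finitelyBased_of_rules {M : Type*} [Monoid M] (rules : List (List ℕ × List ℕ))
    (sound : ∀ r ∈ rules, ListIdentity M r.1 r.2)
    (content : ∀ r ∈ rules, ∀ x, x ∈ r.1 ↔ x ∈ r.2)
    (complete : ∀ R, IsListCon R → ContainsInstances R rules →
      ∀ u v, ListIdentity M u v → R u v) : FinitelyBased M := by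
  set E : Set (Word × Word) := {p | ∃ r ∈ rules, ∃ P : ℕ → Bool,
    letters p.1 = r.1.filter P ∧ letters p.2 = r.2.filter P} with hE
  refine ⟨E, ?_, ?_, ?_⟩
  · have hfin : ∀ l : List ℕ, {w : Word | letters w ∈ l.sublists}.Finite := fun l ↦
      (List.finite_toSet l.sublists).preimage letters_injective.injOn
    refine ((List.finite_toSet rules).biUnion
      (fun r _ ↦ (hfin r.1).prod (hfin r.2))).subset ?_
    rintro p ⟨r, hr, P, h1, h2⟩
    simp only [Set.mem_iUnion]
    refine ⟨r, hr, ?_, ?_⟩ <;> simp [h1, h2]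
  · rintro p ⟨r, hr, P, h1, h2⟩
    refine satisfiesIdentity_iff.2 ?_
    rw [h1, h2]
    exact (sound r hr).filter P
  · intro p hp
    have h := complete (ListDeducible E) (isListCon_listDeducible E) ?_ (letters p.1) (letters p.2)
      (satisfiesIdentity_iff.1 hp)
    · rcases h with h | ⟨U, V, hU, hV, h⟩
      · rw [letters_injective h]
        exact Con.refl _ _
      · rwa [← letters_injective hU, ← letters_injective hV]
    · intro r hr θ
      rw [← flatMap_filter_ne_nil θ r.1, ← flatMap_filter_ne_nil θ r.2]
      by_cases hnil : (r.1.filter fun x ↦ θ x ≠ []) = []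
      · have : (r.2.filter fun x ↦ θ x ≠ []) = [] := by
          simp only [List.filter_eq_nil_iff] at hnil ⊢
          exact fun x hx ↦ hnil x ((content r hr x).2 hx)
        rw [hnil, this]
        exact Or.inl rfl
      · have hnil2 : (r.2.filter fun x ↦ θ x ≠ []) ≠ [] := by
          simp only [ne_eq, List.filter_eq_nil_iff] at hnil ⊢
          exact fun h ↦ hnil fun x hx ↦ h x ((content r hr x).1 hx)
        obtain ⟨U, hU⟩ := exists_letters_eq hnil
        obtain ⟨V, hV⟩ := exists_letters_eq hnil2
        -- Erased variables no longer occur, so their images do not matter.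
        set Θ : Word →ₙ* Word := FreeSemigroup.lift fun x ↦
          if h : θ x = [] then FreeSemigroup.of x else (exists_letters_eq h).choose with hΘ
        have key : ∀ (W : Word) (l : List ℕ), letters W = l.filter (fun x ↦ θ x ≠ []) →
            letters (Θ W) = (l.filter fun x ↦ θ x ≠ []).flatMap θ := by
          intro W l hW
          rw [letters_map, hW]
          refine List.flatMap_congr fun x hx ↦ ?_
          have hx : θ x ≠ [] := by simpa using (List.mem_filter.1 hx).2
          simp only [hΘ, FreeSemigroup.lift_of, hx, dite_false]
          exact (exists_letters_eq hx).choose_spec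
        exact Or.inr ⟨Θ U, Θ V, key U _ hU, key V _ hV,
          ConGen.Rel.of _ _ ⟨(U, V), ⟨r, hr, _, hU, hV⟩, Θ, rfl, rfl⟩⟩

/-! ### Words with the same short subsequences -/

/-- The lists `u` and `v` have the same subsequences of length at most `k`. -/
def SubEquiv (k : ℕ) (u v : List ℕ) : Prop :=
  ∀ s : List ℕ, s.length ≤ k → (s.Sublist u ↔ s.Sublist v)

namespace SubEquiv

variable {k : ℕ} {u v w : List ℕ}

theorem symm (h : SubEquiv k u v) : SubEquiv k v u := fun s hs ↦ (h s hs).symm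

theorem trans (h : SubEquiv k u v) (h' : SubEquiv k v w) : SubEquiv k u w :=
  fun s hs ↦ (h s hs).trans (h' s hs)

theorem reverse (h : SubEquiv k u v) : SubEquiv k u.reverse v.reverse := fun s hs ↦ by
  rw [← List.reverse_sublist, List.reverse_reverse, ← List.reverse_sublist (l₂ := v.reverse),
    List.reverse_reverse]
  exact h _ (by simpa using hs)

/-- A subword sandwiched between equivalent words is equivalent to them. -/
theorem of_sublist (h : SubEquiv k u w) (huv : u.Sublist v) (hvw : v.Sublist w) :
    SubEquiv k u v := fun s hs ↦
  ⟨fun hu ↦ hu.trans huv, fun hv ↦ (h s hs).2 (hv.trans hvw)⟩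

theorem filter (h : SubEquiv k u v) (P : ℕ → Bool) : SubEquiv k (u.filter P) (v.filter P) := by
  intro s hs
  have key : ∀ w : List ℕ, s.Sublist (w.filter P) ↔ s.Sublist w ∧ ∀ x ∈ s, P x := fun w ↦ by
    constructor
    · exact fun hw ↦ ⟨hw.trans List.filter_sublist, fun x hx ↦ (List.mem_filter.1 (hw.mem hx)).2⟩
    · rintro ⟨hw, hP⟩
      have := hw.filter P
      rwa [List.filter_eq_self.2 hP] at this
  rw [key, key, h s hs]

theorem count_eq_of_lt (h : SubEquiv k u v) {x : ℕ} (hx : u.count x < k) :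
    v.count x = u.count x := by
  have key : ∀ n ≤ k, (n ≤ u.count x ↔ n ≤ v.count x) := fun n hn ↦ by
    rw [← List.replicate_sublist_iff, ← List.replicate_sublist_iff]
    exact h _ (by simpa using hn)
  have h1 := key (u.count x) hx.le
  have h2 := key (u.count x + 1) hx
  omega

end SubEquiv

/-- A subsequence of `p x q` either avoids the marked `x`, or uses it. -/
theorem sublist_append_cons_iff {s p q : List ℕ} {x : ℕ} :
    s.Sublist (p ++ x :: q) ↔ s.Sublist (p ++ q) ∨
      ∃ h g, s = h ++ x :: g ∧ h.Sublist p ∧ g.Sublist q := by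
  constructor
  · intro hs
    obtain ⟨s₁, s₂, rfl, h₁, h₂⟩ := List.sublist_append_iff.1 hs
    rcases List.sublist_cons_iff.1 h₂ with h | ⟨g, rfl, hg⟩
    · exact Or.inl (h₁.append h)
    · exact Or.inr ⟨s₁, g, rfl, h₁, hg⟩
  · rintro (h | ⟨h, g, rfl, hh, hg⟩)
    · exact h.trans ((List.Sublist.refl p).append (List.sublist_cons_self x q))
    · exact hh.append (hg.cons_cons x)

/-- If `h x g` is a subsequence of `p q`, then the letter `x` is found in `p` or in `q`. -/
theorem sublist_append_of_append_cons {h g p q : List ℕ} {x : ℕ}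
    (hs : (h ++ x :: g).Sublist (p ++ q)) :
    (h ++ [x]).Sublist p ∨ (x :: g).Sublist q := by
  obtain ⟨l₁, l₂, he, h₁, h₂⟩ := List.sublist_append_iff.1 hs
  rcases List.append_eq_append_iff.1 he with ⟨a, rfl, ha⟩ | ⟨a, rfl, ha⟩
  · cases a with
    | nil =>
      right
      rw [List.nil_append] at ha
      rwa [ha]
    | cons b a =>
      left
      obtain ⟨rfl, rfl⟩ := List.cons_eq_cons.1 ha
      exact List.Sublist.trans (by simp) h₁
  · right
    refine List.Sublist.trans ?_ h₂
    rw [ha]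
    exact List.sublist_append_right _ _

/-- Every subsequence of `p` of length less than `i` can be prolonged by `x` within `p`; this says
that `p` and `p x` have the same subsequences of length at most `i`. -/
def AbsorbsRight (i : ℕ) (p : List ℕ) (x : ℕ) : Prop :=
  ∀ h : List ℕ, h.Sublist p → h.length < i → (h ++ [x]).Sublist p

/-- Every subsequence of `q` of length less than `j` can be preceded by `x` within `q`; this says
that `q` and `x q` have the same subsequences of length at most `j`. -/
def AbsorbsLeft (j : ℕ) (q : List ℕ) (x : ℕ) : Prop :=
  ∀ g : List ℕ, g.Sublist q → g.length < j → (x :: g).Sublist q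

theorem AbsorbsRight.reverse {i : ℕ} {p : List ℕ} {x : ℕ} (h : AbsorbsRight i p x) :
    AbsorbsLeft i p.reverse x := fun g hg hi ↦ by
  have := h g.reverse (by simpa using hg.reverse) (by simpa using hi)
  simpa using this.reverse

theorem AbsorbsLeft.reverse {i : ℕ} {p : List ℕ} {x : ℕ} (h : AbsorbsLeft i p x) :
    AbsorbsRight i p.reverse x := fun g hg hi ↦ by
  have := h g.reverse (by simpa using hg.reverse) (by simpa using hi)
  simpa using this.reverse

theorem absorbs_of_subEquiv {k i j : ℕ} {p q : List ℕ} {x : ℕ}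
    (h : SubEquiv k (p ++ q) (p ++ x :: q)) (hij : i + j ≤ k + 1) :
    AbsorbsRight i p x ∨ AbsorbsLeft j q x := by
  by_contra! hcon
  simp only [AbsorbsRight, AbsorbsLeft] at hcon
  push Not at hcon
  obtain ⟨⟨s, hsp, hsi, hs⟩, t, htq, htj, ht⟩ := hcon
  have : (s ++ x :: t).Sublist (p ++ q) := by
    refine (h _ ?_).2 (hsp.append (htq.cons_cons x))
    simp only [List.length_append, List.length_cons]
    omega
  rcases sublist_append_of_append_cons this with h' | h'
  · exact hs h'
  · exact ht h'

/-- One step of Simon's interpolation: at the first place where two equivalent words differ,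
the letter of one of the words can be inserted into the other. -/
theorem SubEquiv.insert_or_insert {k : ℕ} {u f g : List ℕ} {a b : ℕ} (hab : a ≠ b)
    (h : SubEquiv k (u ++ a :: f) (u ++ b :: g)) :
    SubEquiv k (u ++ a :: f) (u ++ b :: a :: f) ∨ SubEquiv k (u ++ b :: g) (u ++ a :: b :: g) := by
  -- A failing insertion of `b` produces a new subsequence `s b t` using the inserted letter.
  have key : ∀ (a b : ℕ) (f g : List ℕ), SubEquiv k (u ++ a :: f) (u ++ b :: g) →
      ¬ SubEquiv k (u ++ a :: f) (u ++ b :: a :: f) →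
      ∃ s t, (s ++ b :: t).length ≤ k ∧ s.Sublist u ∧ t.Sublist (a :: f) ∧
        ¬ (s ++ [b]).Sublist u ∧ ¬ t.Sublist g := by
    intro a b f g h hn
    simp only [SubEquiv] at hn
    push Not at hn
    obtain ⟨w, hw, hw'⟩ := hn
    have hle : ∀ w : List ℕ, w.Sublist (u ++ a :: f) → w.Sublist (u ++ b :: a :: f) := fun w hw ↦
      sublist_append_cons_iff.2 (Or.inl hw)
    have hw1 : ¬ w.Sublist (u ++ a :: f) ∧ w.Sublist (u ++ b :: a :: f) := by
      have := hle w
      tauto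
    rcases sublist_append_cons_iff.1 hw1.2 with hw2 | ⟨s, t, rfl, hs, ht⟩
    · exact absurd hw2 hw1.1
    · refine ⟨s, t, hw, hs, ht, fun hsb ↦ hw1.1 ?_, fun htg ↦ hw1.1 ?_⟩
      · have := hsb.append ht
        simpa using this
      · exact (h _ hw).2 (hs.append (htg.cons_cons b))
  -- Exchanging the halves of the obstructions for `a` and `b` keeps one of the two exchanged
  -- words short, and that word already gives a contradiction.
  have clash : ∀ (a b : ℕ) (f g t s' : List ℕ), a ≠ b →
      SubEquiv k (u ++ a :: f) (u ++ b :: g) → t.Sublist (a :: f) → ¬ t.Sublist g →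
      s'.Sublist u → ¬ (s' ++ [a]).Sublist u → (s' ++ a :: t).length ≤ k → False := by
    intro a b f g t s' hab h ht htg hs' hs'a hlen
    have use : ∀ r : List ℕ, (s' ++ a :: r).length ≤ k → r.Sublist f → (a :: r).Sublist g := by
      intro r hr hrf
      have hr' := (h _ hr).1 (hs'.append (hrf.cons_cons a))
      rcases sublist_append_of_append_cons hr' with h' | h'
      · exact absurd h' hs'a
      · rcases List.sublist_cons_iff.1 h' with h' | ⟨r', he, _⟩
        · exact h'
        · exact absurd (List.cons_eq_cons.1 he).1 hab
    rcases List.sublist_cons_iff.1 ht with ht | ⟨r, rfl, hr⟩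
    · exact htg ((List.sublist_cons_self a t).trans (use t hlen ht))
    · refine htg (use r ?_ hr)
      simp only [List.length_append, List.length_cons] at hlen ⊢
      omega
  by_contra! hcon
  obtain ⟨s, t, hl, hs, ht, hsb, htg⟩ := key a b f g h hcon.1
  obtain ⟨s', t', hl', hs', ht', hsa, htf⟩ := key b a g f h.symm hcon.2
  simp only [List.length_append, List.length_cons] at hl hl'
  by_cases hle : s'.length + t.length ≤ s.length + t'.length
  · exact clash a b f g t s' hab h ht htg hs' hsa (by simp; omega)
  · exact clash b a g f t' s hab.symm h.symm ht' htf hs hsb (by simp; omega)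

/-- Simon's interpolation theorem: a congruence allowing all insertions of a letter that preserve
the subsequences of length at most `k` contains `SubEquiv k`. -/
theorem IsListCon.of_subEquiv {R : List ℕ → List ℕ → Prop} (hR : IsListCon R) {k : ℕ}
    (ins : ∀ p q x, SubEquiv k (p ++ q) (p ++ x :: q) → R (p ++ q) (p ++ x :: q)) :
    ∀ u v, SubEquiv k u v → R u v := by
  have key : ∀ n, ∀ u f g : List ℕ, f.length + g.length = n → SubEquiv k (u ++ f) (u ++ g) →
      R (u ++ f) (u ++ g) := by
    intro n
    induction n using Nat.strong_induction_on with
    | _ n ih =>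
      -- A word equivalent to its prefix is built up letter by letter.
      have pre : ∀ (u g : List ℕ) (b : ℕ), g.length < n → SubEquiv k u (u ++ b :: g) →
          R u (u ++ b :: g) := by
        intro u g b hg h
        have h1 : SubEquiv k (u ++ []) (u ++ b :: []) :=
          SubEquiv.of_sublist (by simpa using h) (by simp) (by simp)
        have h2 : SubEquiv k ((u ++ [b]) ++ []) ((u ++ [b]) ++ g) := by
          have := h1.symm.trans (v := u ++ []) (w := u ++ b :: g) (by simpa using h)
          simpa using this
        have r1 := ins u [] b h1
        have r2 := ih _ (by simpa using hg) (u ++ [b]) [] g rfl h2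
        simp only [List.append_nil, List.append_assoc, List.singleton_append] at r1 r2
        exact hR.trans r1 r2
      intro u f g hn h
      match f, g with
      | [], [] => exact hR.refl _
      | [], b :: g =>
        simp only [List.append_nil] at h ⊢
        exact pre u g b (by simp at hn; omega) h
      | a :: f, [] =>
        simp only [List.append_nil] at h ⊢
        exact hR.symm (pre u f a (by simp at hn; omega) h.symm)
      | a :: f, b :: g =>
        simp only [List.length_cons] at hn
        by_cases hab : a = b
        · subst hab
          have := ih (f.length + g.length) (by omega) (u ++ [a]) f g rfl (by simpa using h)
          simpa using this
        · rcases h.insert_or_insert hab with h1 | h1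
          · have r1 := ins u (a :: f) b h1
            have := ih ((a :: f).length + g.length) (by simp; omega) (u ++ [b]) (a :: f) g rfl
              (by simpa using h1.symm.trans h)
            exact hR.trans r1 (by simpa using this)
          · have r1 := ins u (b :: g) a h1
            have := ih (f.length + (b :: g).length) (by simp; omega) (u ++ [a]) f (b :: g) rfl
              (by simpa using h.trans h1)
            exact hR.trans (by simpa using this) (hR.symm r1)
  intro u v h
  simpa using key _ [] u v rfl (by simpa using h)

/-! ### A finite basis for the identities preserving subsequences of length three -/

/-- Identities preserving the subsequences of length at most three; the variables are
`x = 0`, `y = 1`, `z = 2`, `t₁ = 3`, `t₂ = 4`. -/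
def subThreeHalfBasis : List (List ℕ × List ℕ) :=
  [([0, 2, 1, 0, 3, 0, 4, 1], [0, 2, 0, 1, 0, 3, 0, 4, 1]),
   ([0, 2, 1, 0, 3, 1, 4, 0], [0, 2, 0, 1, 0, 3, 1, 4, 0]),
   ([1, 0, 1, 0, 1, 0], [0, 1, 0, 1, 0, 1, 0])]

/-- The identities of `subThreeHalfBasis` and their mirror images. -/
def subThreeBasis : List (List ℕ × List ℕ) :=
  subThreeHalfBasis ++ subThreeHalfBasis.map fun r ↦ (r.1.reverse, r.2.reverse)

theorem exists_first_occurrence {x : ℕ} {q : List ℕ} (h : x ∈ q) :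
    ∃ Y r, q = Y ++ x :: r ∧ x ∉ Y := by
  obtain ⟨Y, r, h1, h2⟩ := List.eq_append_cons_of_mem h
  exact ⟨Y, r, h1, h2⟩

section

variable {R : List ℕ → List ℕ → Prop}

theorem subThree_insert_before_one (hR : IsListCon R) (hr : ContainsInstances R subThreeHalfBasis)
    {p q : List ℕ} {x y : ℕ} (hp : x ∈ p) (hxy : y ≠ x) (hx : x ∈ q) (hy : y ∈ q) :
    R (p ++ y :: x :: q) (p ++ x :: y :: x :: q) := by
  obtain ⟨p₀, z, rfl⟩ := List.append_of_mem hp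
  obtain ⟨t₁, q', rfl⟩ := List.append_of_mem hx
  have hθ : ∀ t₁ t₂ : List ℕ, ∃ θ : ℕ → List ℕ,
      θ 0 = [x] ∧ θ 1 = [y] ∧ θ 2 = z ∧ θ 3 = t₁ ∧ θ 4 = t₂ := fun t₁ t₂ ↦
    ⟨fun n ↦ match n with | 0 => [x] | 1 => [y] | 2 => z | 3 => t₁ | _ => t₂, rfl, rfl, rfl, rfl, rfl⟩
  rcases List.mem_append.1 hy with hy | hy
  · obtain ⟨t₁, t₂, rfl⟩ := List.append_of_mem hy
    obtain ⟨θ, h0, h1, h2, h3, h4⟩ := hθ t₁ t₂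
    have := hr ([0, 2, 1, 0, 3, 1, 4, 0], [0, 2, 0, 1, 0, 3, 1, 4, 0])
      (by simp [subThreeHalfBasis]) θ
    simpa [h0, h1, h2, h3, h4] using hR.append p₀ q' this
  · obtain ⟨t₂, q'', rfl⟩ := List.append_of_mem ((List.mem_cons.1 hy).resolve_left hxy)
    obtain ⟨θ, h0, h1, h2, h3, h4⟩ := hθ t₁ t₂
    have := hr ([0, 2, 1, 0, 3, 0, 4, 1], [0, 2, 0, 1, 0, 3, 0, 4, 1])
      (by simp [subThreeHalfBasis]) θ
    simpa [h0, h1, h2, h3, h4] using hR.append p₀ q'' this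

/-- A letter occurring in `p` may be inserted before `Y x q`. The letter is moved through `Y` one
step at a time; the intermediate copies of `x` are removed again in the same way. -/
theorem subThree_insert_before (hR : IsListCon R) (hr : ContainsInstances R subThreeHalfBasis)
    {q : List ℕ} {x : ℕ} (hx : x ∈ q) (Y : List ℕ) (hxY : x ∉ Y) (hY : Y ⊆ q)
    {p : List ℕ} (hp : x ∈ p) :
    R (p ++ (Y ++ x :: q)) (p ++ x :: (Y ++ x :: q)) := by
  induction Y generalizing p with
  | nil =>
    -- The basis with `y` erased.
    obtain ⟨p₀, z, rfl⟩ := List.append_of_mem hp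
    obtain ⟨t₁, q', rfl⟩ := List.append_of_mem hx
    have := hr ([0, 2, 1, 0, 3, 0, 4, 1], [0, 2, 0, 1, 0, 3, 0, 4, 1])
      (by simp [subThreeHalfBasis])
      (fun n ↦ match n with | 0 => [x] | 2 => z | 3 => t₁ | _ => [])
    simpa using hR.append p₀ q' this
  | cons y Y ih =>
    simp only [List.mem_cons, not_or] at hxY
    simp only [List.cons_subset] at hY
    have h1 := ih hxY.2 hY.2 (p := p ++ [y]) (by simp [hp])
    have h2 := subThree_insert_before_one hR hr (p := p) (x := x) (y := y) (q := Y ++ x :: q) hp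
      (Ne.symm hxY.1) (by simp) (by simp [hY.1])
    have h3 := ih hxY.2 hY.2 (p := p ++ [x, y]) (by simp [hp])
    simp only [List.append_assoc, List.cons_append, List.nil_append] at h1 h2 h3 ⊢
    exact hR.trans h1 (hR.trans h2 (hR.symm h3))

theorem subThree_insert_left_two (hR : IsListCon R) (hr : ContainsInstances R subThreeHalfBasis)
    {p q : List ℕ} {x : ℕ} (hp : x ∈ p) (hq : AbsorbsLeft 2 q x) :
    R (p ++ q) (p ++ x :: q) := by
  have hx : x ∈ q := by simpa using hq [] (by simp) (by simp)
  obtain ⟨Y, r, rfl, hxY⟩ := exists_first_occurrence hx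
  have key : ∀ y ∈ Y ++ x :: r, y ∈ r := fun y hy ↦ by
    have h1 := hq [y] (by simpa using hy) (by simp)
    have h2 : ([] ++ x :: [y]).Sublist (Y ++ (x :: r)) := h1
    rcases sublist_append_of_append_cons h2 with h | h
    · exact absurd (by simpa using h) hxY
    · simpa using h
  exact subThree_insert_before hR hr (key x hx) Y hxY (fun y hy ↦ key y (by simp [hy])) hp

/-- With `A` the shortest prefix of `q` containing `x`, two more copies of `A` can be inserted after
`A`, and then the identity `(yx)³ ≈ x(yx)³` applies. -/
theorem subThree_insert_left_three (hR : IsListCon R) (hr : ContainsInstances R subThreeHalfBasis)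
    {q : List ℕ} {x : ℕ} (hq : AbsorbsLeft 3 q x) : R q (x :: q) := by
  have hx : x ∈ q := by simpa using hq [] (by simp) (by simp)
  obtain ⟨Y, r, rfl, hxY⟩ := exists_first_occurrence hx
  set A := Y ++ [x] with hA
  have hq_eq : Y ++ x :: r = A ++ r := by simp [hA]
  rw [hq_eq] at hq ⊢
  have after : ∀ g : List ℕ, g.Sublist (A ++ r) → g.length < 3 → g.Sublist r := fun g hg hl ↦ by
    have h1 := hq g hg hl
    rw [← hq_eq] at h1
    have h2 : ([] ++ x :: g).Sublist (Y ++ (x :: r)) := h1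
    rcases sublist_append_of_append_cons h2 with h | h
    · exact absurd (by simpa using h) hxY
    · exact (List.cons_sublist_cons).1 h
  have ins : ∀ w p : List ℕ, w ⊆ A → A ⊆ p → R (p ++ r) (p ++ (w ++ r)) := by
    intro w
    induction w with
    | nil => exact fun p _ _ ↦ hR.refl _
    | cons y w ih =>
      intro p hw hp
      have hy : y ∈ A := hw (by simp)
      have h1 : R (p ++ r) (p ++ y :: r) := by
        refine subThree_insert_left_two hR hr (hp hy) fun g hg hl ↦ ?_
        refine after (y :: g) ?_ (by simp; omega)
        exact (List.singleton_sublist.2 hy).append hg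
      have h2 := ih (p ++ [y]) (fun z hz ↦ hw (by simp [hz])) (fun z hz ↦ by simp [hp hz])
      simp only [List.append_assoc, List.singleton_append] at h2
      exact hR.trans h1 h2
  have h1 := ins (A ++ A) A (by simp) (by simp)
  have h2 : R (A ++ (A ++ A ++ r)) (x :: (A ++ (A ++ A ++ r))) := by
    have := hr ([1, 0, 1, 0, 1, 0], [0, 1, 0, 1, 0, 1, 0]) (by simp [subThreeHalfBasis])
      (fun n ↦ match n with | 0 => [x] | _ => Y)
    simpa [hA] using hR.append [] r this
  exact hR.trans h1 (hR.trans h2 (hR.symm (hR.append_left [x] h1)))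

theorem IsListCon.reverse (hR : IsListCon R) :
    IsListCon fun u v ↦ R u.reverse v.reverse where
  refl _ := hR.refl _
  symm h := hR.symm h
  trans h h' := hR.trans h h'
  append p q h := by
    have := hR.append q.reverse p.reverse h
    simpa using this

theorem ContainsInstances.reverse {rules : List (List ℕ × List ℕ)}
    (hr : ContainsInstances R (rules.map fun r ↦ (r.1.reverse, r.2.reverse))) :
    ContainsInstances (fun u v ↦ R u.reverse v.reverse) rules := fun r hm θ ↦ by
  have := hr _ (List.mem_map_of_mem hm) (List.reverse ∘ θ)
  simpa only [List.reverse_flatMap] using this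

/-- The identities preserving the subsequences of length at most three follow from
`subThreeBasis`. -/
theorem subThree_complete (hR : IsListCon R) (hr : ContainsInstances R subThreeBasis)
    {u v : List ℕ} (h : SubEquiv 3 u v) : R u v := by
  have hr₁ : ContainsInstances R subThreeHalfBasis := fun r hm ↦
    hr r (List.mem_append_left _ hm)
  have hr₂ : ContainsInstances (fun u v ↦ R u.reverse v.reverse) subThreeHalfBasis :=
    ContainsInstances.reverse fun r hm ↦ hr r (List.mem_append_right _ hm)
  have hR₂ := hR.reverse
  refine hR.of_subEquiv (fun p q x h ↦ ?_) u v h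
  by_cases h3 : AbsorbsLeft 3 q x
  · exact hR.append_left p (subThree_insert_left_three hR hr₁ h3)
  have l1 : AbsorbsRight 1 p x :=
    (absorbs_of_subEquiv h (i := 1) (j := 3) le_rfl).resolve_right h3
  have hxp : x ∈ p := by simpa using l1 [] (by simp) (by simp)
  by_cases h2 : AbsorbsLeft 2 q x
  · exact subThree_insert_left_two hR hr₁ hxp h2
  have l2 : AbsorbsRight 2 p x :=
    (absorbs_of_subEquiv h (i := 2) (j := 2) le_rfl).resolve_right h2
  by_cases h1 : AbsorbsLeft 1 q x
  · have hxq : x ∈ q := by simpa using h1 [] (by simp) (by simp)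
    have := subThree_insert_left_two hR₂ hr₂ (p := q.reverse) (q := p.reverse)
      (by simpa using hxq) l2.reverse
    simpa using this
  have l3 : AbsorbsRight 3 p x :=
    (absorbs_of_subEquiv h (i := 3) (j := 1) le_rfl).resolve_right h1
  have := subThree_insert_left_three hR₂ hr₂ l3.reverse
  have := hR.append_right q this
  simpa using this

end

/-! ### Identities of reflexive relations -/

section

variable {X : Type*}

/-- The value of the list `w` under the substitution `f` of reflexive relations relates `a`
to `c`. -/
def RelatedBy (f : ℕ → ReflRel X) (w : List ℕ) (a c : X) : Prop :=
  (a, c) ∈ (w.map f).prod.1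

theorem relatedBy_nil {f : ℕ → ReflRel X} {a c : X} : RelatedBy f [] a c ↔ a = c := Iff.rfl

theorem relatedBy_cons {f : ℕ → ReflRel X} {x : ℕ} {w : List ℕ} {a c : X} :
    RelatedBy f (x :: w) a c ↔ ∃ b, (a, b) ∈ (f x).1 ∧ RelatedBy f w b c := by
  rw [RelatedBy, List.map_cons, List.prod_cons]
  rfl

theorem ReflRel.refl_mem (r : ReflRel X) (a : X) : (a, a) ∈ r.1 :=
  r.2.refl a

theorem RelatedBy.mono {f : ℕ → ReflRel X} {s w : List ℕ} (h : s.Sublist w) {a c : X}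
    (hs : RelatedBy f s a c) : RelatedBy f w a c := by
  induction h generalizing a with
  | slnil => exact hs
  | cons x _ ih => exact relatedBy_cons.2 ⟨a, (f x).refl_mem a, ih hs⟩
  | cons_cons x _ ih =>
    obtain ⟨b, hb, h⟩ := relatedBy_cons.1 hs
    exact relatedBy_cons.2 ⟨b, hb, ih h⟩

/-- Factors that do not enlarge the set of elements reached so far can be left out, so a product of
reflexive relations is determined by its short subproducts. -/
theorem RelatedBy.exists_short [Finite X] (f : ℕ → ReflRel X) (c : X) (w : List ℕ) (A : Set X)
    (h : ∃ a ∈ A, RelatedBy f w a c) :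
    ∃ s : List ℕ, s.Sublist w ∧ s.length + A.ncard ≤ Nat.card X ∧ ∃ a ∈ A, RelatedBy f s a c := by
  induction w generalizing A with
  | nil => exact ⟨[], List.Sublist.refl _, by simpa using Set.ncard_le_card A, h⟩
  | cons x w ih =>
    set B : Set X := {b | ∃ a ∈ A, (a, b) ∈ (f x).1} with hB
    have hAB : A ⊆ B := fun a ha ↦ ⟨a, ha, (f x).refl_mem a⟩
    obtain ⟨a, ha, hw⟩ := h
    obtain ⟨b, hb, hw⟩ := relatedBy_cons.1 hw
    obtain ⟨s, hs, hl, b', ⟨a', ha', hb'⟩, hc⟩ := ih B ⟨b, ⟨a, ha, hb⟩, hw⟩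
    by_cases hBA : B ⊆ A
    · exact ⟨s, hs.cons x, by rwa [hAB.antisymm hBA], b', hBA ⟨a', ha', hb'⟩, hc⟩
    · have := Set.ncard_lt_ncard (hAB.ssubset_of_not_subset hBA)
      exact ⟨x :: s, hs.cons_cons x, by simp only [List.length_cons]; omega, a', ha',
        relatedBy_cons.2 ⟨b', hb', hc⟩⟩

/-- The substitution reading the list `s` along the chain `0, 1, …, k`: the value of `y` contains
`(i, i + 1)` exactly if the `i`-th entry of `s` is `y`. -/
def staircase (k : ℕ) (s : List ℕ) (y : ℕ) : ReflRel (Fin (k + 1)) :=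
  ⟨{p | p.1 = p.2 ∨ (p.2.1 = p.1.1 + 1 ∧ s[p.1.1]? = some y)}, ⟨fun _ ↦ Or.inl rfl⟩⟩

theorem relatedBy_staircase {k : ℕ} {s : List ℕ} (hs : s.length < k + 1) (w : List ℕ) :
    RelatedBy (staircase k s) w 0 ⟨s.length, hs⟩ ↔ s.Sublist w := by
  constructor
  · have key : ∀ i : Fin (k + 1), RelatedBy (staircase k s) w i ⟨s.length, hs⟩ →
        (s.drop i.1).Sublist w := by
      induction w with
      | nil =>
        intro i h
        rw [relatedBy_nil.1 h]
        simp
      | cons y w ih =>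
        intro i h
        obtain ⟨b, hb, hw⟩ := relatedBy_cons.1 h
        rcases hb with hb | ⟨hb, hy⟩
        · obtain rfl : i = b := hb
          exact (ih i hw).cons y
        · obtain ⟨hlt, rfl⟩ := List.getElem?_eq_some_iff.1 hy
          rw [List.drop_eq_getElem_cons hlt]
          have := ih b hw
          rw [hb] at this
          exact this.cons_cons _
    intro h
    simpa using key 0 h
  · intro h
    refine RelatedBy.mono h ?_
    have key : ∀ (t : List ℕ) (i : Fin (k + 1)), s.drop i.1 = t → i.1 ≤ s.length →
        RelatedBy (staircase k s) t i ⟨s.length, hs⟩ := by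
      intro t
      induction t with
      | nil =>
        intro i hi hle
        refine relatedBy_nil.2 (Fin.ext ?_)
        exact le_antisymm hle (List.drop_eq_nil_iff.1 hi)
      | cons y t ih =>
        intro i hi _
        have hlt : i.1 < s.length := by
          by_contra hge
          rw [List.drop_eq_nil_of_le (not_lt.1 hge)] at hi
          exact absurd hi (by simp)
        rw [List.drop_eq_getElem_cons hlt, List.cons_eq_cons] at hi
        refine relatedBy_cons.2 ⟨⟨i.1 + 1, by omega⟩, Or.inr ⟨rfl, ?_⟩, ih _ hi.2 hlt⟩
        exact List.getElem?_eq_some_iff.2 ⟨hlt, hi.1⟩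
    exact key s 0 (by simp) (by simp)

end

/-- The identities of the reflexive relations on `k + 1` points are those preserving the
subsequences of length at most `k`. -/
theorem listIdentity_reflRel_iff {k : ℕ} {u v : List ℕ} :
    ListIdentity (ReflRel (Fin (k + 1))) u v ↔ SubEquiv k u v := by
  constructor
  · intro h s hs
    have hs' := Nat.lt_succ_of_le hs
    rw [← relatedBy_staircase hs', ← relatedBy_staircase hs', RelatedBy, RelatedBy, h]
  · intro h f
    have key : ∀ u v : List ℕ, SubEquiv k u v → ∀ a c, RelatedBy f u a c → RelatedBy f v a c := by
      intro u v h a c hac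
      obtain ⟨s, hs, hl, a', rfl, hc⟩ := RelatedBy.exists_short f c u {a} ⟨a, rfl, hac⟩
      simp only [Set.ncard_singleton, Nat.card_eq_fintype_card, Fintype.card_fin] at hl
      exact hc.mono ((h s (by omega)).1 hs)
    refine Subtype.ext (Set.ext fun ⟨a, c⟩ ↦ ?_)
    exact ⟨key u v h a c, key v u h.symm a c⟩

instance (u v : List ℕ) : Decidable (SubEquiv 3 u v) :=
  decidable_of_iff ((∀ s ∈ u.sublists, s.length ≤ 3 → s.Sublist v) ∧
    ∀ s ∈ v.sublists, s.length ≤ 3 → s.Sublist u) <| by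
  simp only [List.mem_sublists, SubEquiv]
  exact ⟨fun h s hs ↦ ⟨fun hu ↦ h.1 s hu hs, fun hv ↦ h.2 s hv hs⟩,
    fun h ↦ ⟨fun s hu hs ↦ (h s hs).1 hu, fun s hv hs ↦ (h s hs).2 hv⟩⟩

theorem finitelyBased_reflRel_four : FinitelyBased (ReflRel (Fin 4)) := by
  refine finitelyBased_of_rules subThreeBasis ?_ ?_ ?_
  · have : ∀ r ∈ subThreeBasis, SubEquiv 3 r.1 r.2 := by decide +kernel
    exact fun r hr ↦ listIdentity_reflRel_iff.2 (this r hr)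
  · have : ∀ r ∈ subThreeBasis, r.1 ⊆ r.2 ∧ r.2 ⊆ r.1 := by decide
    exact fun r hr x ↦ ⟨fun h ↦ (this r hr).1 h, fun h ↦ (this r hr).2 h⟩
  · exact fun R hR hr u v h ↦ subThree_complete hR hr (listIdentity_reflRel_iff.1 h)

/-! ### Identities of the monoid of factors of `a t₁ a t₂ a` -/

/-- The word `a t₁ a t₂ a` as a list. -/
def pattern (a t₁ t₂ : ℕ) : List ℕ := [a, t₁, a, t₂, a]

theorem isSubwordOf_singleton_iff {A : Type*} {w u : List A} :
    IsSubwordOf {FreeMonoid.ofList w} (FreeMonoid.ofList u) ↔ u <:+: w := by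
  constructor
  · rintro ⟨w', hw, p, q, h⟩
    obtain rfl : w' = FreeMonoid.ofList w := hw
    exact ⟨p.toList, q.toList, congrArg FreeMonoid.toList h.symm⟩
  · rintro ⟨p, q, h⟩
    exact ⟨_, rfl, FreeMonoid.ofList p, FreeMonoid.ofList q, congrArg FreeMonoid.ofList h.symm⟩

/-- An identity holds in `S({w})` iff every substitution either makes both sides equal or makes
neither of them a factor of `w`. -/
theorem listIdentity_dilworth_iff {w u v : List ℕ} :
    ListIdentity (DilworthMonoid ({FreeMonoid.ofList w} : Set (FreeMonoid ℕ))) u v ↔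
      ∀ σ : ℕ → List ℕ, u.flatMap σ = v.flatMap σ ∨
        (¬ u.flatMap σ <:+: w ∧ ¬ v.flatMap σ <:+: w) := by
  set c := dilworthCon ({FreeMonoid.ofList w} : Set (FreeMonoid ℕ)) with hc
  have key : ∀ (σ : ℕ → List ℕ) (u : List ℕ),
      (u.map fun x ↦ ((FreeMonoid.ofList (σ x) : FreeMonoid ℕ) : c.Quotient)).prod
        = ((FreeMonoid.ofList (u.flatMap σ) : FreeMonoid ℕ) : c.Quotient) := by
    intro σ u
    induction u with
    | nil => rfl
    | cons x u ih => rw [List.map_cons, List.prod_cons, ih]; rfl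
  have rel : ∀ l m : List ℕ, ((FreeMonoid.ofList l : FreeMonoid ℕ) : c.Quotient)
      = (FreeMonoid.ofList m : FreeMonoid ℕ) ↔ (l = m ∨ (¬ l <:+: w ∧ ¬ m <:+: w)) := by
    intro l m
    rw [Con.eq, ← isSubwordOf_singleton_iff, ← isSubwordOf_singleton_iff]
    rfl
  constructor
  · intro h σ
    have := h fun x ↦ ((FreeMonoid.ofList (σ x) : FreeMonoid ℕ) : c.Quotient)
    rwa [key, key, rel] at this
  · intro h f
    choose σ hσ using fun x ↦ Con.mk'_surjective (c := c) (f x)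
    have hf : f = fun x ↦ ((FreeMonoid.ofList (FreeMonoid.toList (σ x)) : FreeMonoid ℕ) :
        c.Quotient) := funext fun x ↦ (hσ x).symm
    rw [hf, key, key, rel]
    exact h _

theorem count_mul_add_le_count_flatMap {x y : ℕ} (hxy : x ≠ y) (σ : ℕ → List ℕ) (c : ℕ)
    (u : List ℕ) :
    u.count x * (σ x).count c + u.count y * (σ y).count c ≤ (u.flatMap σ).count c := by
  induction u with
  | nil => simp
  | cons b u ih =>
    rw [List.flatMap_cons, List.count_append, List.count_cons, List.count_cons]
    by_cases hx : b = x
    · subst hx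
      simp only [beq_self_eq_true, if_true, beq_iff_eq, hxy, if_false, add_mul]
      omega
    · by_cases hy : b = y
      · subst hy
        simp only [beq_self_eq_true, if_true, beq_iff_eq, hx, if_false, add_mul]
        omega
      · simp only [beq_iff_eq, hx, hy, if_false, add_zero]
        omega

theorem count_mul_le_count_flatMap (x : ℕ) (σ : ℕ → List ℕ) (c : ℕ) (u : List ℕ) :
    u.count x * (σ x).count c ≤ (u.flatMap σ).count c :=
  le_trans (Nat.le_add_right _ _)
    (count_mul_add_le_count_flatMap (Nat.succ_ne_self x).symm σ c u)

section

variable {a t₁ t₂ : ℕ} (h₁ : a ≠ t₁) (h₂ : a ≠ t₂) (h₁₂ : t₁ ≠ t₂)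

include h₁ h₂ h₁₂

omit h₂ in
theorem eq_of_two_le_count_pattern {c : ℕ} (h : 2 ≤ (pattern a t₁ t₂).count c) : c = a := by
  by_contra hc
  by_cases hc1 : c = t₁
  · subst hc1
    simp [pattern, h₁, h₁₂.symm] at h
  · simp [pattern, List.count_cons, Ne.symm hc, Ne.symm hc1] at h
    split at h <;> simp at h

omit h₁₂ in
theorem count_pattern_self : (pattern a t₁ t₂).count a = 3 := by
  simp [pattern, h₁.symm, h₂.symm]

omit h₂ in
theorem mem_substituted_eq {u : List ℕ} {σ : ℕ → List ℕ} {x c : ℕ} (hx : 2 ≤ u.count x)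
    (hu : u.flatMap σ <:+: pattern a t₁ t₂) (hc : c ∈ σ x) : c = a := by
  refine eq_of_two_le_count_pattern h₁ h₁₂ ?_
  have h1 := hu.sublist.count_le c
  have h2 := count_mul_le_count_flatMap x σ c u
  have h3 := List.count_pos_iff.2 hc
  nlinarith

omit h₂ in
theorem mem_of_two_le_count {u : List ℕ} {σ : ℕ → List ℕ} {x : ℕ} (hx : 2 ≤ u.count x)
    (hu : u.flatMap σ <:+: pattern a t₁ t₂) (hσ : σ x ≠ []) : a ∈ σ x := by
  obtain ⟨c, hc⟩ := List.exists_mem_of_ne_nil _ hσ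
  rwa [← mem_substituted_eq h₁ h₁₂ hx hu hc]

theorem not_infix_of_two_repeated {u : List ℕ} {σ : ℕ → List ℕ} {x y : ℕ} (hxy : x ≠ y)
    (hx : 2 ≤ u.count x) (hy : 2 ≤ u.count y) (hσx : σ x ≠ []) (hσy : σ y ≠ []) :
    ¬ u.flatMap σ <:+: pattern a t₁ t₂ := fun hu ↦ by
  have h1 := List.count_pos_iff.2 (mem_of_two_le_count h₁ h₁₂ hx hu hσx)
  have h2 := List.count_pos_iff.2 (mem_of_two_le_count h₁ h₁₂ hy hu hσy)
  have h3 := count_mul_add_le_count_flatMap hxy σ a u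
  have h4 := hu.sublist.count_le a
  rw [count_pattern_self h₁ h₂] at h4
  nlinarith

theorem not_infix_of_four_le_count {u : List ℕ} {σ : ℕ → List ℕ} {x : ℕ}
    (hx : 4 ≤ u.count x) (hσx : σ x ≠ []) : ¬ u.flatMap σ <:+: pattern a t₁ t₂ := fun hu ↦ by
  have h1 := List.count_pos_iff.2 (mem_of_two_le_count h₁ h₁₂ (by omega) hu hσx)
  have h3 := count_mul_le_count_flatMap x σ a u
  have h4 := hu.sublist.count_le a
  rw [count_pattern_self h₁ h₂] at h4
  nlinarith

theorem not_infix_of_square {p q : List ℕ} {σ : ℕ → List ℕ} {x : ℕ} (hσx : σ x ≠ []) :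
    ¬ (p ++ x :: x :: q).flatMap σ <:+: pattern a t₁ t₂ := fun hu ↦ by
  have hc : 2 ≤ (p ++ x :: x :: q).count x := by
    simp only [List.count_append, List.count_cons_self]
    omega
  have hall : ∀ c ∈ σ x, c = a := fun c ↦ mem_substituted_eq h₁ h₁₂ hc hu
  have hrep := List.eq_replicate_iff.2 ⟨rfl, hall⟩
  obtain ⟨n, hn⟩ : ∃ n, (σ x).length = n + 1 :=
    Nat.exists_eq_succ_of_ne_zero (by simpa using hσx)
  rw [hn] at hrep
  have h2 : [a, a] <:+: (p ++ x :: x :: q).flatMap σ := by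
    refine ⟨p.flatMap σ ++ List.replicate n a, List.replicate n a ++ q.flatMap σ, ?_⟩
    have h3 : σ x = List.replicate n a ++ [a] := by rw [hrep, List.replicate_succ']
    have h4 : σ x = a :: List.replicate n a := by rw [hrep, List.replicate_succ]
    rw [List.flatMap_append, List.flatMap_cons, List.flatMap_cons]
    conv_rhs => enter [2, 1]; rw [h3]
    conv_rhs => enter [2, 2]; rw [h4]
    simp
  have h3 := h2.trans hu
  simp [pattern, List.infix_cons_iff, List.prefix_cons_iff, h₁, h₂] at h3

end

/-! ### Restrictions of words to sets of letters -/

/-- The word obtained from `u` by deleting the letters outside `A`. -/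
def restrict (A : Finset ℕ) (u : List ℕ) : List ℕ := u.filter (· ∈ A)

section

variable {A B : Finset ℕ} {u v : List ℕ}

theorem restrict_cons_of_mem {x : ℕ} (h : x ∈ A) : restrict A (x :: u) = x :: restrict A u := by
  simp [restrict, h]

theorem restrict_cons_of_notMem {x : ℕ} (h : x ∉ A) : restrict A (x :: u) = restrict A u := by
  simp [restrict, h]

theorem restrict_append : restrict A (u ++ v) = restrict A u ++ restrict A v := by
  simp [restrict]

theorem mem_restrict {x : ℕ} : x ∈ restrict A u ↔ x ∈ u ∧ x ∈ A := by simp [restrict]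

theorem restrict_eq_nil_of_forall_notMem (h : ∀ x ∈ u, x ∉ A) : restrict A u = [] := by
  simpa [restrict] using h

theorem restrict_restrict (h : B ⊆ A) : restrict B (restrict A u) = restrict B u := by
  simp only [restrict, List.filter_filter]
  refine List.filter_congr fun x _ ↦ ?_
  by_cases hx : x ∈ B
  · simp [hx, h hx]
  · simp [hx]

theorem restrict_mono (h : B ⊆ A) (huv : restrict A u = restrict A v) :
    restrict B u = restrict B v := by
  rw [← restrict_restrict h, huv, restrict_restrict h]

theorem count_restrict {x : ℕ} (h : x ∈ A) : (restrict A u).count x = u.count x := by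
  simp [restrict, List.count_filter, h]

theorem count_eq_of_restrict_eq {x : ℕ} (h : x ∈ A) (huv : restrict A u = restrict A v) :
    u.count x = v.count x := by
  rw [← count_restrict h, huv, count_restrict h]

theorem restrict_singleton {x : ℕ} : restrict {x} u = List.replicate (u.count x) x := by
  rw [List.eq_replicate_iff]
  refine ⟨?_, fun b hb ↦ by simpa using (mem_restrict.1 hb).2⟩
  rw [← count_restrict (Finset.mem_singleton_self x), List.count_eq_length.2]
  exact fun b hb ↦ (by simpa using (mem_restrict.1 hb).2 : b = x).symm

/-- A word is determined by its restrictions to pairs of letters. -/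
theorem restrict_eq_of_pairs
    (h : ∀ y ∈ A, ∀ z ∈ A, restrict {y, z} u = restrict {y, z} v) :
    restrict A u = restrict A v := by
  have key : ∀ u v : List ℕ, (∀ x ∈ u, x ∈ A) → (∀ x ∈ v, x ∈ A) →
      (∀ y ∈ A, ∀ z ∈ A, restrict {y, z} u = restrict {y, z} v) → u = v := by
    intro u
    induction u with
    | nil =>
      intro v _ hv h
      cases v with
      | nil => rfl
      | cons b v =>
        have hb := hv b (by simp)
        have := h b hb b hb
        rw [restrict_cons_of_mem (by simp)] at this
        simp [restrict] at this
    | cons a u ih =>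
      intro v hu hv h
      have ha := hu a (by simp)
      cases v with
      | nil =>
        have := h a ha a ha
        rw [restrict_cons_of_mem (by simp)] at this
        simp [restrict] at this
      | cons b v =>
        have hb := hv b (by simp)
        have hab := h a ha b hb
        rw [restrict_cons_of_mem (by simp), restrict_cons_of_mem (by simp)] at hab
        obtain rfl := (List.cons_eq_cons.1 hab).1
        rw [ih v (fun x hx ↦ hu x (by simp [hx])) (fun x hx ↦ hv x (by simp [hx]))]
        intro y hy z hz
        have hyz := h y hy z hz
        by_cases hmem : a ∈ ({y, z} : Finset ℕ)
        · rw [restrict_cons_of_mem hmem, restrict_cons_of_mem hmem] at hyz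
          exact (List.cons_eq_cons.1 hyz).2
        · rwa [restrict_cons_of_notMem hmem, restrict_cons_of_notMem hmem] at hyz
  refine key _ _ (fun x hx ↦ (mem_restrict.1 hx).2) (fun x hx ↦ (mem_restrict.1 hx).2) ?_
  intro y hy z hz
  have hsub : ({y, z} : Finset ℕ) ⊆ A := by
    intro x hx
    simp only [Finset.mem_insert, Finset.mem_singleton] at hx
    rcases hx with rfl | rfl <;> assumption
  rw [restrict_restrict hsub, restrict_restrict hsub]
  exact h y hy z hz

theorem exists_take_drop_of_append_eq {p q l : List ℕ} (h : p ++ q = l) :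
    ∃ n ≤ l.length, p = l.take n ∧ q = l.drop n :=
  ⟨p.length, by simp [← h], by simp [← h], by simp [← h]⟩

/-- Adding one letter with a single occurrence amounts to inserting it somewhere. -/
theorem exists_restrict_insert {r : ℕ} (hr : u.count r = 1) (hrA : r ∉ A) :
    ∃ p q, restrict (insert r A) u = p ++ r :: q ∧ restrict A u = p ++ q := by
  have hmem : r ∈ restrict (insert r A) u :=
    mem_restrict.2 ⟨List.count_pos_iff.1 (by omega), by simp⟩
  obtain ⟨p, q, h⟩ := List.append_of_mem hmem
  refine ⟨p, q, h, ?_⟩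
  have hc := count_restrict (u := u) (Finset.mem_insert_self r A)
  rw [h, hr, List.count_append, List.count_cons_self] at hc
  have hp : r ∉ p := List.count_eq_zero.1 (by omega)
  have hq : r ∉ q := List.count_eq_zero.1 (by omega)
  have hin : ∀ x ∈ p ++ r :: q, x = r ∨ x ∈ A := fun x hx ↦ by
    rw [← h] at hx
    simpa using (mem_restrict.1 hx).2
  have self : ∀ l : List ℕ, (∀ x ∈ l, x ∈ A) → restrict A l = l := fun l hl ↦ by
    simpa [restrict] using hl
  rw [← restrict_restrict (Finset.subset_insert r A), h, restrict_append,
    restrict_cons_of_notMem hrA, self p, self q]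
  · exact fun x hx ↦ (hin x (by simp [hx])).resolve_left fun he ↦ hq (he ▸ hx)
  · exact fun x hx ↦ (hin x (by simp [hx])).resolve_left fun he ↦ hp (he ▸ hx)

end

theorem eq_of_map_eq {A : Finset ℕ} {π : ℕ → ℕ} (hπ : ∀ x ∈ A, ∀ y ∈ A, π x = π y → x = y)
    {l m : List ℕ} (hl : ∀ x ∈ l, x ∈ A) (hm : ∀ x ∈ m, x ∈ A) (h : l.map π = m.map π) : l = m := by
  induction l generalizing m with
  | nil => simpa [eq_comm] using h
  | cons x l ih =>
    cases m with
    | nil => simp at h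
    | cons y m =>
      rw [List.map_cons, List.map_cons, List.cons_eq_cons] at h
      rw [hπ x (hl x (by simp)) y (hm y (by simp)) h.1,
        ih (fun z hz ↦ hl z (by simp [hz])) (fun z hz ↦ hm z (by simp [hz])) h.2]

theorem restrict_pair_of_count_one {w : List ℕ} {r s : ℕ} (hrs : r ≠ s) (hr : w.count r = 1)
    (hs : w.count s = 1) : restrict {r, s} w = [r, s] ∨ restrict {r, s} w = [s, r] := by
  obtain ⟨p, q, h1, h2⟩ := exists_restrict_insert (A := {s}) hr (by simpa using hrs)
  rw [restrict_singleton, hs, List.replicate_one, eq_comm, List.append_eq_singleton_iff] at h2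
  rw [h1]
  rcases h2 with ⟨rfl, rfl⟩ | ⟨rfl, rfl⟩ <;> simp

/-! ### Restrictions determined by the identities of the monoid of factors -/

/-- `u ≈ v` is an identity of the monoid of factors of `a t₁ a t₂ a`. -/
abbrev PatternIdentity (a t₁ t₂ : ℕ) (u v : List ℕ) : Prop :=
  ListIdentity (DilworthMonoid ({FreeMonoid.ofList (pattern a t₁ t₂)} : Set (FreeMonoid ℕ))) u v

section

variable {a t₁ t₂ : ℕ} {u v : List ℕ}

theorem PatternIdentity.flatMap_eq (h : PatternIdentity a t₁ t₂ u v) {σ : ℕ → List ℕ}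
    (hu : u.flatMap σ <:+: pattern a t₁ t₂) : v.flatMap σ = u.flatMap σ := by
  rcases listIdentity_dilworth_iff.1 h σ with h | h
  · exact h.symm
  · exact absurd hu h.1

/-- If the restriction of `u` to `A` can be renamed to a factor of `a t₁ a t₂ a`, then `v` has the
same restriction. -/
theorem PatternIdentity.restrict_eq (h : PatternIdentity a t₁ t₂ u v) {A : Finset ℕ} (π : ℕ → ℕ)
    (hπ : ∀ x ∈ A, ∀ y ∈ A, π x = π y → x = y)
    (hu : (restrict A u).map π <:+: pattern a t₁ t₂) : restrict A v = restrict A u := by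
  set σ : ℕ → List ℕ := fun x ↦ if x ∈ A then [π x] else [] with hσ
  have key : ∀ w : List ℕ, w.flatMap σ = (restrict A w).map π := fun w ↦ by
    induction w with
    | nil => rfl
    | cons x w ih =>
      by_cases hx : x ∈ A
      · simp [restrict_cons_of_mem hx, hσ, hx, ← ih]
      · simp [restrict_cons_of_notMem hx, hσ, hx, ← ih]
  have := h.flatMap_eq (σ := σ) (by rwa [key])
  rw [key, key] at this
  exact eq_of_map_eq hπ (fun x hx ↦ (mem_restrict.1 hx).2) (fun x hx ↦ (mem_restrict.1 hx).2) this

theorem PatternIdentity.count_eq_of_le_one (h : PatternIdentity a t₁ t₂ u v) {x : ℕ}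
    (hx : u.count x ≤ 1) : v.count x = u.count x := by
  refine count_eq_of_restrict_eq (Finset.mem_singleton_self x)
    (h.restrict_eq (A := {x}) (fun _ ↦ a) (by simp) ?_)
  rw [restrict_singleton]
  interval_cases u.count x
  · exact ⟨[], _, rfl⟩
  · exact ⟨[], [t₁, a, t₂, a], rfl⟩

theorem PatternIdentity.two_le_count (h : PatternIdentity a t₁ t₂ u v) {x : ℕ}
    (hx : 2 ≤ u.count x) : 2 ≤ v.count x := by
  by_contra hv
  have h' : PatternIdentity a t₁ t₂ v u := h.symm
  have := h'.count_eq_of_le_one (x := x) (by omega)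
  omega

section

variable (h₁ : a ≠ t₁) (h₂ : a ≠ t₂) (h₁₂ : t₁ ≠ t₂)
include h₁

theorem PatternIdentity.restrict_eq_of_xtx (h : PatternIdentity a t₁ t₂ u v) {x t : ℕ}
    (hxt : x ≠ t) (hu : restrict {x, t} u = [x, t, x]) :
    restrict {x, t} v = restrict {x, t} u := by
  refine h.restrict_eq (fun z ↦ if z = x then a else t₁) ?_ ?_
  · intro y hy z hz
    simp only [Finset.mem_insert, Finset.mem_singleton] at hy hz
    rcases hy with rfl | rfl <;> rcases hz with rfl | rfl <;> simp [hxt, hxt.symm, h₁, h₁.symm]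
  · rw [hu]
    exact ⟨[], [t₂, a], by simp [pattern, hxt.symm]⟩

include h₂ h₁₂

/-- If `u` restricts to a factor of `x t x s x`, then so does `v`, and to the same one: substitute
`a`, `t₁`, `t₂` for `x`, `t`, `s`. -/
theorem PatternIdentity.restrict_eq_of_three (h : PatternIdentity a t₁ t₂ u v) {x t s : ℕ}
    (hxt : x ≠ t) (hxs : x ≠ s) (hts : t ≠ s)
    (hu : restrict {x, t, s} u <:+: pattern x t s) :
    restrict {x, t, s} v = restrict {x, t, s} u := by
  refine h.restrict_eq (fun z ↦ if z = x then a else if z = t then t₁ else t₂) ?_ ?_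
  · intro y hy z hz
    simp only [Finset.mem_insert, Finset.mem_singleton] at hy hz
    rcases hy with rfl | rfl | rfl <;> rcases hz with rfl | rfl | rfl <;>
      simp [hxt, hxt.symm, hxs, hxs.symm, hts, hts.symm, h₁, h₁.symm, h₂, h₂.symm, h₁₂, h₁₂.symm]
  · have := hu.map (fun z ↦ if z = x then a else if z = t then t₁ else t₂)
    simpa [pattern, hxt.symm, hxs.symm, hts.symm] using this

omit h₁ h₂ in
/-- Letters occurring once keep their order: substitute `t₁ a` for the first and `t₂` for the
second. -/
theorem PatternIdentity.restrict_eq_of_linear (h : PatternIdentity a t₁ t₂ u v) {r s : ℕ}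
    (hr : u.count r = 1) (hs : u.count s = 1) : restrict {r, s} v = restrict {r, s} u := by
  by_cases hrs : r = s
  · subst hrs
    simp only [Finset.pair_eq_singleton, restrict_singleton,
      h.count_eq_of_le_one (x := r) (by omega)]
  have key : ∀ r s : ℕ, r ≠ s → u.count r = 1 → u.count s = 1 → restrict {r, s} u = [r, s] →
      restrict {r, s} v = [r, s] := by
    intro r s hrs hr hs hu
    set σ : ℕ → List ℕ := fun z ↦ if z = r then [t₁, a] else if z = s then [t₂] else [] with hσ
    have hσw : ∀ w : List ℕ, w.flatMap σ = (restrict {r, s} w).flatMap σ := fun w ↦ by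
      induction w with
      | nil => rfl
      | cons z w ih =>
        by_cases hz : z ∈ ({r, s} : Finset ℕ)
        · rw [restrict_cons_of_mem hz, List.flatMap_cons, List.flatMap_cons, ih]
        · have hz' : z ≠ r ∧ z ≠ s := by simpa using hz
          rw [restrict_cons_of_notMem hz, List.flatMap_cons, ih]
          simp [hσ, hz'.1, hz'.2]
    have hval := h.flatMap_eq (σ := σ) (by
      rw [hσw, hu]
      exact ⟨[a], [a], by simp [hσ, hrs.symm, pattern]⟩)
    rw [hσw, hσw u, hu] at hval
    rcases restrict_pair_of_count_one (w := v) hrs (by rw [h.count_eq_of_le_one (by omega), hr])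
      (by rw [h.count_eq_of_le_one (by omega), hs]) with hv | hv
    · exact hv
    · rw [hv] at hval
      simp [hσ, hrs.symm, h₁₂.symm] at hval
  rcases restrict_pair_of_count_one hrs hr hs with hu | hu
  · rw [hu, key r s hrs hr hs hu]
  · rw [Finset.pair_comm] at hu ⊢
    rw [hu, key s r (Ne.symm hrs) hs hr hu]

end

/-- The letter `x` occurs two or three times in `u`, and its occurrences are separated by letters
that occur once. -/
def Spread (u : List ℕ) (x : ℕ) : Prop :=
  (∃ t, x ≠ t ∧ restrict {x, t} u = [x, t, x]) ∨
    ∃ t s, x ≠ t ∧ x ≠ s ∧ t ≠ s ∧ restrict {x, t, s} u = [x, t, x, s, x]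

section

variable (h₁ : a ≠ t₁) (h₂ : a ≠ t₂) (h₁₂ : t₁ ≠ t₂)
include h₁ h₂ h₁₂

theorem PatternIdentity.spread (h : PatternIdentity a t₁ t₂ u v) {x : ℕ} (hx : Spread u x) :
    Spread v x := by
  rcases hx with ⟨t, hxt, hu⟩ | ⟨t, s, hxt, hxs, hts, hu⟩
  · exact Or.inl ⟨t, hxt, (h.restrict_eq_of_xtx h₁ hxt hu).trans hu⟩
  · refine Or.inr ⟨t, s, hxt, hxs, hts, ?_⟩
    exact (h.restrict_eq_of_three h₁ h₂ h₁₂ hxt hxs hts (by rw [hu]; exact List.infix_rfl)).trans hu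

theorem PatternIdentity.count_eq_of_spread (h : PatternIdentity a t₁ t₂ u v) {x : ℕ}
    (hx : Spread u x) : v.count x = u.count x := by
  rcases hx with ⟨t, hxt, hu⟩ | ⟨t, s, hxt, hxs, hts, hu⟩
  · exact count_eq_of_restrict_eq (by simp) (h.restrict_eq_of_xtx h₁ hxt hu)
  · exact count_eq_of_restrict_eq (by simp)
      (h.restrict_eq_of_three h₁ h₂ h₁₂ hxt hxs hts (by rw [hu]; exact List.infix_rfl))

/-- A spread letter keeps its position relative to every letter occurring once. -/
theorem PatternIdentity.restrict_eq_of_spread (h : PatternIdentity a t₁ t₂ u v) {x r : ℕ}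
    (hx : Spread u x) (hr : u.count r = 1) : restrict {x, r} v = restrict {x, r} u := by
  have hrv : v.count r = 1 := by rw [h.count_eq_of_le_one (by omega), hr]
  rcases hx with ⟨t, hxt, hu⟩ | ⟨t, s, hxt, hxs, hts, hu⟩
  · have htu : u.count t = 1 := by
      rw [← count_restrict (A := {x, t}) (by simp), hu]
      simp [hxt]
    by_cases hrt : r = t
    · subst hrt
      exact h.restrict_eq_of_xtx h₁ hxt hu
    have hrx : r ≠ x := fun he ↦ by
      subst he
      rw [← count_restrict (A := {r, t}) (by simp), hu] at hr
      simp [List.count_cons] at hr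
    obtain ⟨p, q, h1, h2⟩ := exists_restrict_insert (A := {x, t}) hr (by simp [hrx, hrt])
    rw [hu, eq_comm] at h2
    obtain ⟨n, hn, rfl, rfl⟩ := exists_take_drop_of_append_eq h2
    have hsub : ({x, r} : Finset ℕ) ⊆ insert r {x, t} := by simp [Finset.insert_subset_iff]
    have hset : ({x, r, t} : Finset ℕ) = insert r {x, t} := Finset.insert_comm _ _ _
    have hset' : ({x, t, r} : Finset ℕ) = insert r {x, t} := by
      rw [← hset, Finset.pair_comm]
    have hxru := restrict_restrict (u := u) hsub
    rw [h1] at hxru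
    simp only [List.length_cons, List.length_nil] at hn
    interval_cases n
    · refine restrict_mono hsub ?_
      rw [← hset]
      refine h.restrict_eq_of_three h₁ h₂ h₁₂ (Ne.symm hrx) hxt hrt ?_
      rw [hset, h1]
      exact ⟨[x], [], rfl⟩
    · refine h.restrict_eq_of_xtx h₁ (Ne.symm hrx) ?_
      simpa [restrict, Ne.symm hxt, Ne.symm hrt] using hxru.symm
    · refine h.restrict_eq_of_xtx h₁ (Ne.symm hrx) ?_
      simpa [restrict, Ne.symm hxt, Ne.symm hrt] using hxru.symm
    · refine restrict_mono hsub ?_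
      rw [← hset']
      refine h.restrict_eq_of_three h₁ h₂ h₁₂ hxt (Ne.symm hrx) (Ne.symm hrt) ?_
      rw [hset', h1]
      exact ⟨[], [x], rfl⟩
  · have hv := (h.restrict_eq_of_three h₁ h₂ h₁₂ hxt hxs hts
      (by rw [hu]; exact List.infix_rfl)).trans hu
    have htu : u.count t = 1 := by
      rw [← count_restrict (A := {x, t, s}) (by simp), hu]
      simp [hxt, hts.symm]
    have hsu : u.count s = 1 := by
      rw [← count_restrict (A := {x, t, s}) (by simp), hu]
      simp [hxs, hts]
    by_cases hrt : r = t
    · subst hrt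
      exact restrict_mono (A := {x, r, s}) (by simp [Finset.insert_subset_iff]) (hv.trans hu.symm)
    by_cases hrs : r = s
    · subst hrs
      exact restrict_mono (A := {x, t, r}) (by simp [Finset.insert_subset_iff]) (hv.trans hu.symm)
    have hrx : r ≠ x := fun he ↦ by
      subst he
      rw [← count_restrict (A := {r, t, s}) (by simp), hu] at hr
      simp [List.count_cons] at hr
    have hrA : r ∉ ({x, t, s} : Finset ℕ) := by simp [hrx, hrt, hrs]
    have h' : PatternIdentity a t₁ t₂ v u := h.symm
    -- The order of `r`, `t`, `s` is preserved; within a gap between two of these letters, the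
    -- factors `x r x s x` and `x t x r x` show on which side of the `x` in that gap `r` stands.
    have e₁ := h.restrict_eq_of_linear h₁₂ hr htu
    have e₂ := h.restrict_eq_of_linear h₁₂ hr hsu
    have e₃ : restrict {x, r, s} u = [x, r, x, s, x] ↔ restrict {x, r, s} v = [x, r, x, s, x] :=
      ⟨fun hw ↦ (h.restrict_eq_of_three h₁ h₂ h₁₂ (Ne.symm hrx) hxs hrs
        (by rw [hw]; exact List.infix_rfl)).trans hw,
      fun hw ↦ (h'.restrict_eq_of_three h₁ h₂ h₁₂ (Ne.symm hrx) hxs hrs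
        (by rw [hw]; exact List.infix_rfl)).trans hw⟩
    have e₄ : restrict {x, t, r} u = [x, t, x, r, x] ↔ restrict {x, t, r} v = [x, t, x, r, x] :=
      ⟨fun hw ↦ (h.restrict_eq_of_three h₁ h₂ h₁₂ hxt (Ne.symm hrx) (Ne.symm hrt)
        (by rw [hw]; exact List.infix_rfl)).trans hw,
      fun hw ↦ (h'.restrict_eq_of_three h₁ h₂ h₁₂ hxt (Ne.symm hrx) (Ne.symm hrt)
        (by rw [hw]; exact List.infix_rfl)).trans hw⟩
    have hsub : ∀ B : Finset ℕ, B ⊆ insert r {x, t, s} → ∀ w,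
        restrict B w = restrict B (restrict (insert r {x, t, s}) w) :=
      fun B hB w ↦ (restrict_restrict hB).symm
    have b₁ := hsub {r, t} (by simp [Finset.insert_subset_iff])
    have b₂ := hsub {r, s} (by simp [Finset.insert_subset_iff])
    have b₃ := hsub {x, r, s} (by simp [Finset.insert_subset_iff])
    have b₄ := hsub {x, t, r} (by simp [Finset.insert_subset_iff])
    have b₅ := hsub {x, r} (by simp [Finset.insert_subset_iff])
    obtain ⟨p, q, hU, hpq⟩ := exists_restrict_insert hr hrA
    obtain ⟨p', q', hV, hpq'⟩ := exists_restrict_insert hrv hrA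
    rw [hu, eq_comm] at hpq
    rw [hv, eq_comm] at hpq'
    obtain ⟨n, hn, rfl, rfl⟩ := exists_take_drop_of_append_eq hpq
    obtain ⟨m, hm, rfl, rfl⟩ := exists_take_drop_of_append_eq hpq'
    rw [b₁, b₁ u, hU, hV] at e₁
    rw [b₂, b₂ u, hU, hV] at e₂
    rw [b₃, b₃ v, hU, hV] at e₃
    rw [b₄, b₄ v, hU, hV] at e₄
    rw [b₅, b₅ u, hU, hV]
    clear b₁ b₂ b₃ b₄ b₅ hsub hU hV hpq hpq' hu hv h h'
    simp only [List.length_cons, List.length_nil] at hn hm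
    interval_cases n <;> interval_cases m <;>
      simp_all [restrict, Ne.symm hxt, Ne.symm hxs, Ne.symm hts, Ne.symm hrx, Ne.symm hrt,
        Ne.symm hrs]

end

end

/-! ### A finite basis for the monoid of factors -/

/-- A finite basis of the identities of the monoid of factors of `a t₁ a t₂ a`; the variables are
`x = 0`, `y = 1` and separators `2, 3, 4`. The first three identities interchange adjacent letters
that both occur elsewhere; the others say that `x²` is central and absorbs further occurrences
of `x`, and that four occurrences of `x` amount to `x²`. -/
def patternBasis : List (List ℕ × List ℕ) :=
  [([0, 2, 1, 3, 0, 1], [0, 2, 1, 3, 1, 0]),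
   ([0, 2, 0, 1, 3, 1], [0, 2, 1, 0, 3, 1]),
   ([0, 1, 2, 0, 3, 1], [1, 0, 2, 0, 3, 1]),
   ([0, 0, 2], [2, 0, 0]),
   ([0, 0, 2, 0], [0, 0, 2]),
   ([0, 2, 0, 3, 0, 4, 0], [0, 0, 2, 3, 4])]

theorem patternBasis_sound {a t₁ t₂ : ℕ} (h₁ : a ≠ t₁) (h₂ : a ≠ t₂) (h₁₂ : t₁ ≠ t₂) :
    ∀ r ∈ patternBasis, PatternIdentity a t₁ t₂ r.1 r.2 := by
  have two : ∀ r : List ℕ × List ℕ, 2 ≤ r.1.count 0 ∧ 2 ≤ r.1.count 1 ∧ 2 ≤ r.2.count 0 ∧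
      2 ≤ r.2.count 1 → (∀ σ : ℕ → List ℕ, σ 0 = [] ∨ σ 1 = [] →
      r.1.flatMap σ = r.2.flatMap σ) → PatternIdentity a t₁ t₂ r.1 r.2 := by
    rintro r ⟨c₁, c₂, c₃, c₄⟩ heq
    refine listIdentity_dilworth_iff.2 fun σ ↦ ?_
    by_cases h : σ 0 = [] ∨ σ 1 = []
    · exact Or.inl (heq σ h)
    · rw [not_or] at h
      exact Or.inr ⟨not_infix_of_two_repeated h₁ h₂ h₁₂ zero_ne_one c₁ c₂ h.1 h.2,
        not_infix_of_two_repeated h₁ h₂ h₁₂ zero_ne_one c₃ c₄ h.1 h.2⟩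
  intro r hr
  simp only [patternBasis, List.mem_cons, List.not_mem_nil, or_false] at hr
  rcases hr with rfl | rfl | rfl | rfl | rfl | rfl
  · exact two _ (by decide) (by rintro σ (h | h) <;> simp [h])
  · exact two _ (by decide) (by rintro σ (h | h) <;> simp [h])
  · exact two _ (by decide) (by rintro σ (h | h) <;> simp [h])
  all_goals
    refine listIdentity_dilworth_iff.2 fun σ ↦ ?_
    by_cases h : σ 0 = []
    · left
      simp [h]
  · exact Or.inr ⟨not_infix_of_square h₁ h₂ h₁₂ (p := []) (q := [2]) h,
      not_infix_of_square h₁ h₂ h₁₂ (p := [2]) (q := []) h⟩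
  · exact Or.inr ⟨not_infix_of_square h₁ h₂ h₁₂ (p := []) (q := [2, 0]) h,
      not_infix_of_square h₁ h₂ h₁₂ (p := []) (q := [2]) h⟩
  · exact Or.inr ⟨not_infix_of_four_le_count h₁ h₂ h₁₂ (x := 0) (by decide) h,
      not_infix_of_square h₁ h₂ h₁₂ (p := []) (q := [2, 3, 4]) h⟩

theorem exists_split_first {x : ℕ} {w : List ℕ} (hw : 1 ≤ w.count x) :
    ∃ p q, w = p ++ x :: q ∧ x ∉ p ∧ q.count x + 1 = w.count x := by
  obtain ⟨p, q, rfl, hp⟩ := exists_first_occurrence (List.count_pos_iff.1 hw)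
  exact ⟨p, q, rfl, hp, by simp [List.count_append, List.count_eq_zero.2 hp]⟩

theorem restrict_of_two_separators {x t s : ℕ} {p Y Z q u : List ℕ}
    (hu : u = p ++ x :: (Y ++ x :: (Z ++ x :: q))) (hxp : x ∉ p) (hxY : x ∉ Y) (hxZ : x ∉ Z)
    (hxq : x ∉ q) (htY : t ∈ Y) (hsZ : s ∈ Z) (ht : u.count t = 1) (hs : u.count s = 1) :
    x ≠ t ∧ x ≠ s ∧ t ≠ s ∧ restrict {x, t, s} u = [x, t, x, s, x] := by
  have hxt : x ≠ t := fun he ↦ hxY (he ▸ htY)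
  have hxs : x ≠ s := fun he ↦ hxZ (he ▸ hsZ)
  obtain ⟨Y₁, Y₂, rfl⟩ := List.append_of_mem htY
  obtain ⟨Z₁, Z₂, rfl⟩ := List.append_of_mem hsZ
  have hts : t ≠ s := fun he ↦ by
    subst he
    simp only [hu, List.count_append, List.count_cons, beq_self_eq_true, if_true, beq_iff_eq, hxt,
      if_false] at ht
    omega
  simp only [hu, List.count_append, List.count_cons, beq_self_eq_true, if_true,
    beq_iff_eq, hxs, hxt, hts, hts.symm, if_false] at ht hs
  have nil : ∀ l : List ℕ, x ∉ l → l.count t = 0 → l.count s = 0 → restrict {x, t, s} l = [] :=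
    fun l hx ht hs ↦ restrict_eq_nil_of_forall_notMem fun z hz ↦ by
      rw [List.count_eq_zero] at ht hs
      simp only [Finset.mem_insert, Finset.mem_singleton, not_or]
      exact ⟨fun he ↦ hx (he ▸ hz), fun he ↦ ht (he ▸ hz), fun he ↦ hs (he ▸ hz)⟩
  simp only [List.mem_append, List.mem_cons, not_or] at hxY hxZ
  refine ⟨hxt, hxs, hts, ?_⟩
  rw [hu]
  simp only [restrict_append, restrict_cons_of_mem, Finset.mem_insert, Finset.mem_singleton,
    true_or, or_true, nil p hxp (by omega) (by omega), nil Y₁ hxY.1 (by omega) (by omega),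
    nil Y₂ hxY.2.2 (by omega) (by omega), nil Z₁ hxZ.1 (by omega) (by omega),
    nil Z₂ hxZ.2.2 (by omega) (by omega), nil q hxq (by omega) (by omega), List.nil_append,
    List.cons_append]

section

variable {R : List ℕ → List ℕ → Prop} (hR : IsListCon R) (hr : ContainsInstances R patternBasis)
include hR hr

theorem pattern_swap {p q : List ℕ} {x y : ℕ} (hxy : x ≠ y) (hx : x ∈ p ++ q)
    (hy : y ∈ p ++ q) : R (p ++ x :: y :: q) (p ++ y :: x :: q) := by
  -- The variables `x`, `y` of the basis may be exchanged.
  have hθ : ∀ x y : ℕ, ∀ z t : List ℕ, ∃ θ : ℕ → List ℕ,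
      θ 0 = [x] ∧ θ 1 = [y] ∧ θ 2 = z ∧ θ 3 = t := fun x y z t ↦
    ⟨fun n ↦ match n with | 0 => [x] | 1 => [y] | 2 => z | _ => t, rfl, rfl, rfl, rfl⟩
  have left : ∀ x y : ℕ, ∀ p₀ z t : List ℕ,
      R ((p₀ ++ x :: (z ++ y :: t)) ++ x :: y :: q) ((p₀ ++ x :: (z ++ y :: t)) ++ y :: x :: q) := by
    intro x y p₀ z t
    obtain ⟨θ, h0, h1, h2, h3⟩ := hθ x y z t
    have := hr ([0, 2, 1, 3, 0, 1], [0, 2, 1, 3, 1, 0]) (by simp [patternBasis]) θ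
    simpa [h0, h1, h2, h3] using hR.append p₀ q this
  have mid : ∀ x y : ℕ, x ∈ p → y ∈ q → R (p ++ x :: y :: q) (p ++ y :: x :: q) := by
    clear hx hy
    intro x y hx hy
    obtain ⟨p₀, z, rfl⟩ := List.append_of_mem hx
    obtain ⟨t, q₀, rfl⟩ := List.append_of_mem hy
    obtain ⟨θ, h0, h1, h2, h3⟩ := hθ x y z t
    have := hr ([0, 2, 0, 1, 3, 1], [0, 2, 1, 0, 3, 1]) (by simp [patternBasis]) θ
    simpa [h0, h1, h2, h3] using hR.append p₀ q₀ this
  have right : ∀ x y : ℕ, ∀ z t q₀ : List ℕ,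
      R (p ++ x :: y :: (z ++ x :: (t ++ y :: q₀))) (p ++ y :: x :: (z ++ x :: (t ++ y :: q₀))) := by
    intro x y z t q₀
    obtain ⟨θ, h0, h1, h2, h3⟩ := hθ x y z t
    have := hr ([0, 1, 2, 0, 3, 1], [1, 0, 2, 0, 3, 1]) (by simp [patternBasis]) θ
    simpa [h0, h1, h2, h3] using hR.append p q₀ this
  have split : ∀ l : List ℕ, x ∈ l → y ∈ l → (∃ p₀ z t, l = p₀ ++ x :: (z ++ y :: t)) ∨
      ∃ p₀ z t, l = p₀ ++ y :: (z ++ x :: t) := by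
    intro l hx hy
    obtain ⟨p₀, t, rfl⟩ := List.append_of_mem hx
    rcases List.mem_append.1 hy with hy | hy
    · obtain ⟨p₁, z, rfl⟩ := List.append_of_mem hy
      exact Or.inr ⟨p₁, z, t, by simp⟩
    · obtain ⟨z, t', rfl⟩ := List.append_of_mem ((List.mem_cons.1 hy).resolve_left hxy.symm)
      exact Or.inl ⟨p₀, z, t', rfl⟩
  rcases List.mem_append.1 hx with hx | hx <;> rcases List.mem_append.1 hy with hy | hy
  · rcases split p hx hy with ⟨p₀, z, t, rfl⟩ | ⟨p₀, z, t, rfl⟩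
    · exact left x y p₀ z t
    · exact hR.symm (left y x p₀ z t)
  · exact mid x y hx hy
  · exact hR.symm (mid y x hy hx)
  · rcases split q hx hy with ⟨z, t, q₀, rfl⟩ | ⟨z, t, q₀, rfl⟩
    · exact right x y z t q₀
    · exact hR.symm (right y x z t q₀)

/-- A letter moves through a block of repeated letters. -/
theorem pattern_swap_block {x : ℕ} {q : List ℕ} (Y : List ℕ) (hxY : x ∉ Y) {p : List ℕ}
    (hx : x ∈ p ++ q) (hY : ∀ y ∈ Y, 2 ≤ (p ++ (Y ++ q)).count y) :
    R (p ++ x :: (Y ++ q)) (p ++ (Y ++ x :: q)) := by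
  induction Y generalizing p with
  | nil => exact hR.refl _
  | cons y Y ih =>
    simp only [List.mem_cons, not_or] at hxY
    have hy : y ∈ p ++ (Y ++ q) := by
      have := hY y (by simp)
      simp only [List.cons_append, List.count_append, List.count_cons_self] at this
      rw [← List.count_pos_iff, List.count_append, List.count_append]
      omega
    have h1 := pattern_swap hR hr (p := p) (q := Y ++ q) hxY.1 (by
      simp only [List.mem_append] at hx ⊢
      tauto) hy
    have h2 := ih hxY.2 (p := p ++ [y]) (by
      simp only [List.mem_append] at hx ⊢
      tauto) (fun z hz ↦ by simpa using hY z (by simp [hz]))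
    simp only [List.append_assoc, List.cons_append, List.nil_append] at h1 h2 ⊢
    exact hR.trans h1 h2

/-- A square `x²` can be moved to the front, where it absorbs all other occurrences of `x`. -/
theorem pattern_collect_square (x : ℕ) (p q : List ℕ) :
    R (p ++ x :: x :: q) (x :: x :: (p ++ q).filter (· ≠ x)) := by
  have front : R (p ++ x :: x :: q) (x :: x :: (p ++ q)) := by
    have := hr ([0, 0, 2], [2, 0, 0]) (by simp [patternBasis])
      (fun n ↦ match n with | 0 => [x] | _ => p)
    simpa using hR.append [] q (hR.symm this)
  have absorb : ∀ w p : List ℕ, R (x :: x :: (p ++ w)) (x :: x :: (p ++ w.filter (· ≠ x))) := by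
    intro w
    induction w with
    | nil => exact fun p ↦ hR.refl _
    | cons y w ih =>
      intro p
      by_cases hy : y = x
      · subst hy
        have := hr ([0, 0, 2, 0], [0, 0, 2]) (by simp [patternBasis])
          (fun n ↦ match n with | 0 => [y] | _ => p)
        have := hR.append [] w this
        refine hR.trans ?_ (hR.trans (ih p) ?_)
        · simpa using this
        · simpa using hR.refl _
      · have := ih (p ++ [y])
        simpa [hy] using this
  exact hR.trans front (absorb (p ++ q) [])

/-- A repeated letter that is not spread can be collected in a square at the front. -/
theorem pattern_collect {u : List ℕ} {x : ℕ} (hx : 2 ≤ u.count x) (hs : ¬ Spread u x) :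
    R u (x :: x :: u.filter (· ≠ x)) := by
  -- Two occurrences with only repeated letters in between can be made adjacent.
  have close : ∀ p Y q : List ℕ, u = p ++ x :: (Y ++ x :: q) → x ∉ Y →
      (∀ y ∈ Y, 2 ≤ u.count y) → R u (x :: x :: u.filter (· ≠ x)) := by
    intro p Y q hu hxY hY
    have h1 := pattern_swap_block hR hr (x := x) (q := x :: q) (p := p) Y hxY (by simp) (by
      intro y hy
      have := hY y hy
      have hyx : x ≠ y := fun he ↦ hxY (he ▸ hy)
      simpa [hu, List.count_append, List.count_cons, hyx] using this)
    rw [← hu] at h1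
    have h2 := pattern_collect_square hR hr x (p ++ Y) q
    rw [List.append_assoc] at h2
    have h3 := hR.trans h1 h2
    simpa [hu] using h3
  have linear : ∀ Y : List ℕ, Y ⊆ u → ¬ (∀ y ∈ Y, 2 ≤ u.count y) → ∃ t ∈ Y, u.count t = 1 := by
    intro Y hYu h
    push Not at h
    obtain ⟨t, ht, hlt⟩ := h
    have := List.count_pos_iff.2 (hYu ht)
    exact ⟨t, ht, by omega⟩
  obtain ⟨p, u₁, hu, hxp, c₁⟩ := exists_split_first (x := x) (w := u) (by omega)
  obtain ⟨Y, u₂, hu₁, hxY, c₂⟩ := exists_split_first (x := x) (w := u₁) (by omega)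
  by_cases hY : ∀ y ∈ Y, 2 ≤ u.count y
  · exact close p Y u₂ (by rw [hu, hu₁]) hxY hY
  obtain ⟨t, htY, ht⟩ := linear Y (fun z hz ↦ by simp [hu, hu₁, hz]) hY
  have hxt : x ≠ t := fun he ↦ hxY (he ▸ htY)
  obtain ⟨Y₁, Y₂, rfl⟩ := List.append_of_mem htY
  have ht' := ht
  simp only [hu, hu₁, List.count_append, List.count_cons, beq_self_eq_true, if_true,
    beq_iff_eq, hxt, if_false] at ht'
  have t₁ : t ∉ p := List.count_eq_zero.1 (by omega)
  have t₂ : t ∉ Y₁ := List.count_eq_zero.1 (by omega)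
  have t₃ : t ∉ Y₂ := List.count_eq_zero.1 (by omega)
  have t₄ : t ∉ u₂ := List.count_eq_zero.1 (by omega)
  have x₁ : x ∉ Y₁ := fun h ↦ hxY (by simp [h])
  have x₂ : x ∉ Y₂ := fun h ↦ hxY (by simp [h])
  by_cases c₃ : u₂.count x = 0
  · refine absurd (Or.inl ⟨t, hxt, ?_⟩) hs
    have x₃ := List.count_eq_zero.1 c₃
    have nil : ∀ l : List ℕ, x ∉ l → t ∉ l → restrict {x, t} l = [] := fun l hx ht ↦
      restrict_eq_nil_of_forall_notMem fun z hz ↦ by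
        simp only [Finset.mem_insert, Finset.mem_singleton, not_or]
        exact ⟨fun he ↦ hx (he ▸ hz), fun he ↦ ht (he ▸ hz)⟩
    rw [hu, hu₁]
    simp [restrict_append, restrict_cons_of_mem, *]
  obtain ⟨Z, u₃, hu₂, hxZ, c₄⟩ := exists_split_first (x := x) (w := u₂) (by omega)
  by_cases hZ : ∀ z ∈ Z, 2 ≤ u.count z
  · exact close (p ++ x :: (Y₁ ++ t :: Y₂)) Z u₃ (by rw [hu, hu₁, hu₂]; simp) hxZ hZ
  obtain ⟨s, hsZ, hsu⟩ := linear Z (fun z hz ↦ by simp [hu, hu₁, hu₂, hz]) hZ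
  by_cases c₅ : u₃.count x = 0
  · exact absurd (Or.inr ⟨t, s, restrict_of_two_separators (by rw [hu, hu₁, hu₂]) hxp hxY hxZ
      (List.count_eq_zero.1 c₅) htY hsZ ht hsu⟩) hs
  obtain ⟨Z₁, Z₂, rfl⟩ := List.append_of_mem hsZ
  obtain ⟨V, u₄, hu₃, -, -⟩ := exists_split_first (x := x) (w := u₃) (by omega)
  have := hr ([0, 2, 0, 3, 0, 4, 0], [0, 0, 2, 3, 4]) (by simp [patternBasis])
    (fun n ↦ match n with | 0 => [x] | 2 => Y₁ ++ t :: Y₂ | 3 => Z₁ ++ s :: Z₂ | _ => V)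
  have h1 : R u (p ++ x :: x :: ((Y₁ ++ t :: Y₂) ++ ((Z₁ ++ s :: Z₂) ++ (V ++ u₄)))) := by
    rw [hu, hu₁, hu₂, hu₃]
    simpa using hR.append p u₄ this
  have h2 := hR.trans h1 (pattern_collect_square hR hr x _ _)
  have h3 : u.filter (· ≠ x)
      = (p ++ ((Y₁ ++ t :: Y₂) ++ ((Z₁ ++ s :: Z₂) ++ (V ++ u₄)))).filter (· ≠ x) := by
    rw [hu, hu₁, hu₂, hu₃]
    simp [List.filter_cons]
  rwa [← h3] at h2

/-- Two words agree modulo interchanging adjacent repeated letters if every repeated letter has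
the same position relative to the set `A` of the letters that are not moved. -/
theorem pattern_sort (A : Finset ℕ) (u : List ℕ) {p v : List ℕ}
    (h : ∀ y, restrict (insert y A) u = restrict (insert y A) v)
    (hc : ∀ y ∈ p ++ v, y ∉ A → 2 ≤ (p ++ v).count y) : R (p ++ u) (p ++ v) := by
  induction u generalizing p v with
  | nil =>
    cases v with
    | nil => exact hR.refl _
    | cons y v =>
      have := h y
      rw [restrict_cons_of_mem (by simp)] at this
      simp [restrict] at this
  | cons x u ih =>
    have hx := h x
    rw [restrict_cons_of_mem (by simp), eq_comm, restrict, List.filter_eq_cons_iff] at hx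
    obtain ⟨v₁, v₂, rfl, hv₁, -, -⟩ := hx
    have hv₁' : ∀ y ∈ v₁, y ≠ x ∧ y ∉ A := fun y hy ↦ by simpa using hv₁ y hy
    have hxA : v₁ ≠ [] → x ∉ A := fun hne hxA ↦ by
      obtain ⟨z, w, rfl⟩ := List.exists_cons_of_ne_nil hne
      have := h z
      rw [restrict_cons_of_mem (by simp [hxA]), List.cons_append,
        restrict_cons_of_mem (by simp)] at this
      exact (hv₁' z (by simp)).1 (List.cons_eq_cons.1 this).1.symm
    have hmove : R (p ++ x :: (v₁ ++ v₂)) (p ++ (v₁ ++ x :: v₂)) := by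
      by_cases hv : v₁ = []
      · rw [hv]
        exact hR.refl _
      · have hxA := hxA hv
        have hxc := hc x (by simp) hxA
        have count : ∀ y, y ≠ x → (p ++ (v₁ ++ x :: v₂)).count y
            = (p ++ (v₁ ++ v₂)).count y := fun y hy ↦ by
          simp [List.count_append, Ne.symm hy]
        refine pattern_swap_block hR hr v₁ (fun hm ↦ (hv₁' x hm).1 rfl) ?_ fun y hy ↦ ?_
        · have hx0 : v₁.count x = 0 := List.count_eq_zero.2 fun hm ↦ (hv₁' x hm).1 rfl
          rw [← List.count_pos_iff]
          simp only [List.count_append, List.count_cons_self] at hxc ⊢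
          omega
        · rw [← count y (hv₁' y hy).1]
          exact hc y (by simp [hy]) (hv₁' y hy).2
    refine hR.trans ?_ hmove
    have := ih (p := p ++ [x]) (v := v₁ ++ v₂) (fun y ↦ ?_) (fun y hy hyA ↦ ?_)
    · simpa using this
    · have hy := h y
      by_cases hxm : x ∈ insert y A
      · rw [restrict_cons_of_mem hxm, restrict_append, restrict_cons_of_mem hxm] at hy
        have hnil : restrict (insert y A) v₁ = [] := by
          rcases Finset.mem_insert.1 hxm with rfl | hxm
          · refine restrict_eq_nil_of_forall_notMem fun z hz ↦ ?_
            simpa using hv₁' z hz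
          · rw [not_imp_not.1 hxA hxm]
            rfl
        rw [hnil, List.nil_append, List.cons_eq_cons] at hy
        rw [restrict_append, hnil, hy.2, List.nil_append]
      · rwa [restrict_cons_of_notMem hxm, restrict_append, restrict_cons_of_notMem hxm,
          ← restrict_append] at hy
    · have hperm : (p ++ [x] ++ (v₁ ++ v₂)).Perm (p ++ (v₁ ++ x :: v₂)) := by
        rw [List.append_assoc]
        exact (List.perm_middle (l₁ := v₁) (l₂ := v₂) (a := x)).symm.append_left p
      rw [hperm.count_eq]
      exact hc y (hperm.mem_iff.1 hy) hyA

end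

/-- The identities of the monoid of factors of `a t₁ a t₂ a` follow from `patternBasis`. Repeated
letters that are not spread are collected at the front and then deleted, after which the words agree
up to the order of the repeated letters between two letters occurring once. -/
theorem pattern_complete {R : List ℕ → List ℕ → Prop} (hR : IsListCon R)
    (hr : ContainsInstances R patternBasis) {a t₁ t₂ : ℕ} (h₁ : a ≠ t₁) (h₂ : a ≠ t₂)
    (h₁₂ : t₁ ≠ t₂) (u v : List ℕ) (h : PatternIdentity a t₁ t₂ u v) : R u v := by
  induction hn : u.length using Nat.strong_induction_on generalizing u v with
  | _ n ih =>
    have h' : PatternIdentity a t₁ t₂ v u := h.symm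
    by_cases hbad : ∃ x, 2 ≤ u.count x ∧ ¬ Spread u x
    · obtain ⟨x, hx, hs⟩ := hbad
      have hsv : ¬ Spread v x := fun hsv ↦ hs (h'.spread h₁ h₂ h₁₂ hsv)
      have hu := pattern_collect hR hr hx hs
      have hv := pattern_collect hR hr (h.two_le_count hx) hsv
      have hlt : (u.filter (· ≠ x)).length < u.length := by
        have hmem : x ∈ u := List.count_pos_iff.1 (by omega)
        exact List.length_filter_lt_length_iff_exists.2 ⟨x, hmem, by simp⟩
      have := ih _ (hn ▸ hlt) _ _ (h.filter _) rfl
      exact hR.trans hu (hR.trans (hR.append_left [x, x] this) (hR.symm hv))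
    · push Not at hbad
      set A : Finset ℕ := u.toFinset.filter fun x ↦ u.count x = 1 with hA
      have hmemA : ∀ x, x ∈ A ↔ u.count x = 1 := fun x ↦ by
        simp only [hA, Finset.mem_filter, List.mem_toFinset, and_iff_right_iff_imp]
        exact fun hx ↦ List.count_pos_iff.1 (by omega)
      have hcount : ∀ y, u.count y = v.count y := fun y ↦ by
        by_cases hy : 2 ≤ u.count y
        · exact (h.count_eq_of_spread h₁ h₂ h₁₂ (hbad y hy)).symm
        · exact (h.count_eq_of_le_one (by omega)).symm
      have pair : ∀ y r, u.count r = 1 → restrict {y, r} u = restrict {y, r} v := by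
        intro y r hr
        by_cases hy : 2 ≤ u.count y
        · exact (h.restrict_eq_of_spread h₁ h₂ h₁₂ (hbad y hy) hr).symm
        · by_cases hy1 : u.count y = 1
          · exact (h.restrict_eq_of_linear h₁₂ hy1 hr).symm
          · have hyu : u.count y = 0 := by omega
            have hyv : v.count y = 0 := by rw [← hcount, hyu]
            have drop : ∀ w : List ℕ, w.count y = 0 → restrict {y, r} w = restrict {r} w :=
              fun w hw ↦ List.filter_congr fun z hz ↦ by
                have : z ≠ y := fun he ↦ List.count_eq_zero.1 hw (he ▸ hz)
                simp [this]
            rw [drop u hyu, drop v hyv, restrict_singleton, restrict_singleton, hcount]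
      refine pattern_sort hR hr A u (p := []) (v := v) (fun y ↦ ?_) (fun y hy hyA ↦ ?_)
      · refine restrict_eq_of_pairs fun z hz w hw ↦ ?_
        rw [Finset.mem_insert, hmemA] at hz hw
        rcases hw with rfl | hw
        · rcases hz with rfl | hz
          · rw [Finset.pair_eq_singleton, restrict_singleton, restrict_singleton, hcount]
          · rw [Finset.pair_comm]
            exact pair w z hz
        · exact pair z w hw
      · rw [hmemA, hcount] at hyA
        rw [List.nil_append] at hy ⊢
        have := List.count_pos_iff.2 hy
        omega

theorem finitelyBased_pattern {a t₁ t₂ : ℕ} (h₁ : a ≠ t₁) (h₂ : a ≠ t₂) (h₁₂ : t₁ ≠ t₂) :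
    FinitelyBased
      (DilworthMonoid ({FreeMonoid.ofList (pattern a t₁ t₂)} : Set (FreeMonoid ℕ))) := by
  refine finitelyBased_of_rules patternBasis (patternBasis_sound h₁ h₂ h₁₂) ?_ ?_
  · have : ∀ r ∈ patternBasis, r.1 ⊆ r.2 ∧ r.2 ⊆ r.1 := by decide
    exact fun r hr x ↦ ⟨fun h ↦ (this r hr).1 h, fun h ↦ (this r hr).2 h⟩
  · exact fun R hR hr u v h ↦ pattern_complete hR hr h₁ h₂ h₁₂ u v h

/-! ### An identity of the product that needs many variables -/

theorem listIdentity_prod_iff {M N : Type*} [Monoid M] [Monoid N] {u v : List ℕ} :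
    ListIdentity (M × N) u v ↔ ListIdentity M u v ∧ ListIdentity N u v := by
  have fst : ∀ (f : ℕ → M × N) (w : List ℕ),
      (w.map f).prod = ((w.map fun x ↦ (f x).1).prod, (w.map fun x ↦ (f x).2).prod) := by
    intro f w
    induction w with
    | nil => rfl
    | cons x w ih => simp only [List.map_cons, List.prod_cons, ih]; rfl
  constructor
  · intro h
    refine ⟨fun f ↦ ?_, fun f ↦ ?_⟩
    · have := h fun x ↦ (f x, 1)
      rw [fst, fst] at this
      exact (Prod.mk.inj this).1
    · have := h fun x ↦ (1, f x)
      rw [fst, fst] at this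
      exact (Prod.mk.inj this).2
  · rintro ⟨h, h'⟩ f
    rw [fst, fst, h, h']

/-- The word `x t y₁ ⋯ yₖ x yₖ ⋯ y₁ x` with `x = 0`, `t = 1` and `Y = [y₁, …, yₖ]`. -/
def mirrorWord (Y : List ℕ) : List ℕ := [0, 1] ++ (Y ++ 0 :: (Y.reverse ++ [0]))

/-- The word `x t x y₁ ⋯ yₖ x yₖ ⋯ y₁ x`. -/
def mirrorWord' (Y : List ℕ) : List ℕ := [0, 1] ++ 0 :: (Y ++ 0 :: (Y.reverse ++ [0]))

theorem subEquiv_mirrorWord (Y : List ℕ) : SubEquiv 3 (mirrorWord Y) (mirrorWord' Y) := by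
  intro s hs
  rw [mirrorWord, mirrorWord', sublist_append_cons_iff]
  refine ⟨Or.inl, ?_⟩
  rintro (h | ⟨h, g, rfl, hh, hg⟩)
  · exact h
  cases h with
  | nil => exact (hg.cons 1).cons_cons 0
  | cons b h =>
    refine hh.append ?_
    simp only [List.length_append, List.length_cons] at hs
    match g, hg with
    | [], _ => simp
    | [z], hg =>
      refine List.Sublist.trans (List.Sublist.cons_cons 0 (List.singleton_sublist.2 ?_))
        (List.sublist_append_right Y _)
      have : z ∈ Y ++ 0 :: (Y.reverse ++ [0]) := List.singleton_sublist.1 hg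
      simp only [List.mem_append, List.mem_cons, List.mem_reverse, List.not_mem_nil,
        or_false] at this ⊢
      tauto
    | _ :: _ :: _, _ => simp only [List.length_cons] at hs; omega

theorem patternIdentity_mirrorWord {a t₁ t₂ : ℕ} (h₁ : a ≠ t₁) (h₂ : a ≠ t₂) (h₁₂ : t₁ ≠ t₂)
    {Y : List ℕ} (hY : 0 ∉ Y) : PatternIdentity a t₁ t₂ (mirrorWord Y) (mirrorWord' Y) := by
  refine listIdentity_dilworth_iff.2 fun σ ↦ ?_
  by_cases h0 : σ 0 = []
  · left
    simp [mirrorWord, mirrorWord', h0]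
  refine Or.inr ⟨?_, not_infix_of_four_le_count h₁ h₂ h₁₂ (x := 0) ?_ h0⟩
  · by_cases hσ : ∀ y ∈ Y, σ y = []
    · have nil : Y.flatMap σ = [] := List.flatMap_eq_nil_iff.2 hσ
      have nil' : Y.reverse.flatMap σ = [] := List.flatMap_eq_nil_iff.2 (by simpa using hσ)
      have : (mirrorWord Y).flatMap σ = ([0, 1] ++ 0 :: 0 :: []).flatMap σ := by
        simp [mirrorWord, List.flatMap_append, nil, nil']
      rw [this]
      exact not_infix_of_square h₁ h₂ h₁₂ h0
    · push Not at hσ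
      obtain ⟨y, hy, hσy⟩ := hσ
      have hy0 : 0 ≠ y := fun he ↦ hY (he ▸ hy)
      refine not_infix_of_two_repeated h₁ h₂ h₁₂ hy0 ?_ ?_ h0 hσy
      · simp only [mirrorWord, List.count_append, List.count_cons_self]
        omega
      · have := List.count_pos_iff.2 hy
        simp only [mirrorWord, List.count_append, List.count_cons, List.count_reverse]
        omega
  · simp only [mirrorWord', List.count_append, List.count_cons_self, List.cons_append,
      List.nil_append, List.count_cons]
    simp
    omega

section

variable {Y : List ℕ} (hnd : Y.Nodup) (h0 : 0 ∉ Y) (h1 : 1 ∉ Y)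

include h0 in
theorem count_zero_mirrorWord : (mirrorWord Y).count 0 = 3 := by
  simp [mirrorWord, List.count_append, List.count_eq_zero.2 h0]

include h1 in
theorem count_one_mirrorWord : (mirrorWord Y).count 1 = 1 := by
  simp [mirrorWord, List.count_append, List.count_eq_zero.2 h1]

include hnd h1 in
theorem count_mirrorWord_le {z : ℕ} (hz : z ≠ 0) : (mirrorWord Y).count z ≤ 2 := by
  by_cases hz1 : z = 1
  · rw [hz1, count_one_mirrorWord h1]
    omega
  · have := List.nodup_iff_count_le_one.1 hnd z
    simp [mirrorWord, List.count_append, Ne.symm hz, Ne.symm hz1]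
    omega

include hnd h0 h1 in
theorem restrict_pair_mirrorWord {b c : ℕ} (hb : b ∈ Y) (hc : c ∈ Y) (hbc : b ≠ c) :
    restrict {b, c} (mirrorWord Y) = [b, c, c, b] ∨
      restrict {b, c} (mirrorWord Y) = [c, b, b, c] := by
  have h0' : (0 : ℕ) ∉ ({b, c} : Finset ℕ) := by
    simp only [Finset.mem_insert, Finset.mem_singleton, not_or]
    exact ⟨fun he ↦ h0 (he ▸ hb), fun he ↦ h0 (he ▸ hc)⟩
  have h1' : (1 : ℕ) ∉ ({b, c} : Finset ℕ) := by
    simp only [Finset.mem_insert, Finset.mem_singleton, not_or]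
    exact ⟨fun he ↦ h1 (he ▸ hb), fun he ↦ h1 (he ▸ hc)⟩
  have hrev : restrict {b, c} Y.reverse = (restrict {b, c} Y).reverse := by simp [restrict]
  have hval : restrict {b, c} (mirrorWord Y)
      = restrict {b, c} Y ++ (restrict {b, c} Y).reverse := by
    rw [mirrorWord, List.cons_append, List.cons_append, restrict_cons_of_notMem h0',
      restrict_cons_of_notMem h1', List.nil_append, restrict_append, restrict_cons_of_notMem h0',
      restrict_append, hrev, restrict_cons_of_notMem h0']
    simp [restrict]
  rw [hval]
  rcases restrict_pair_of_count_one hbc (List.count_eq_one_of_mem hnd hb)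
    (List.count_eq_one_of_mem hnd hc) with h | h <;> simp [h]

end

/-! ### Words over two letters determined by their short subsequences -/

theorem SubEquiv.map {k : ℕ} {u v : List ℕ} (h : SubEquiv k u v) (ρ : ℕ → ℕ) :
    SubEquiv k (u.map ρ) (v.map ρ) := by
  have key : ∀ u v : List ℕ, SubEquiv k u v → ∀ s : List ℕ, s.length ≤ k →
      s.Sublist (u.map ρ) → s.Sublist (v.map ρ) := by
    intro u v h s hs hu
    obtain ⟨l, hl, rfl⟩ := List.sublist_map_iff.1 hu
    exact ((h l (by simpa using hs)).1 hl).map ρ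
  exact fun s hs ↦ ⟨key u v h s hs, key v u h.symm s hs⟩

/-- All words of length `n` over the letters `0` and `1`. -/
def binaryWords : ℕ → List (List ℕ)
  | 0 => [[]]
  | n + 1 => (binaryWords n).flatMap fun l ↦ [0 :: l, 1 :: l]

theorem mem_binaryWords {l : List ℕ} (h : ∀ x ∈ l, x = 0 ∨ x = 1) :
    l ∈ binaryWords l.length := by
  induction l with
  | nil => simp [binaryWords]
  | cons x l ih =>
    simp only [List.length_cons, binaryWords, List.mem_flatMap]
    refine ⟨l, ih fun y hy ↦ h y (by simp [hy]), ?_⟩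
    rcases h x (by simp) with rfl | rfl <;> simp

/-- Words over `0` and `1` determined by their length and their subsequences of length at most
three. -/
def rigidWords : List (List ℕ) := [[0, 1, 1], [0, 1, 1, 0], [0, 1, 0, 0], [0, 1, 0, 1, 0]]

theorem eq_of_subEquiv_rigid :
    ∀ w ∈ rigidWords, ∀ l ∈ binaryWords w.length, SubEquiv 3 w l → l = w := by
  decide +kernel

theorem restrict_eq_of_rigid {u v : List ℕ} (h : SubEquiv 3 u v)
    (hc : ∀ z, v.count z = u.count z) {b c : ℕ} (hbc : b ≠ c) {w : List ℕ} (hw : w ∈ rigidWords)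
    (hu : restrict {b, c} u = w.map fun i ↦ if i = 0 then b else c) :
    restrict {b, c} v = restrict {b, c} u := by
  set ρ : ℕ → ℕ := fun z ↦ if z = b then 0 else 1 with hρ
  have hρinj : ∀ x ∈ ({b, c} : Finset ℕ), ∀ y ∈ ({b, c} : Finset ℕ), ρ x = ρ y → x = y := by
    intro x hx y hy
    simp only [Finset.mem_insert, Finset.mem_singleton] at hx hy
    rcases hx with rfl | rfl <;> rcases hy with rfl | rfl <;> simp [hρ, hbc.symm]
  have hmem : ∀ w : List ℕ, ∀ x ∈ restrict {b, c} w, x ∈ ({b, c} : Finset ℕ) :=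
    fun w x hx ↦ (mem_restrict.1 hx).2
  have hperm : (restrict {b, c} v).Perm (restrict {b, c} u) := List.perm_iff_count.2 fun z ↦ by
    by_cases hz : z ∈ ({b, c} : Finset ℕ)
    · rw [count_restrict hz, count_restrict hz, hc]
    · rw [List.count_eq_zero.2 fun h ↦ hz (hmem _ _ h),
        List.count_eq_zero.2 fun h ↦ hz (hmem _ _ h)]
  have hwbin : ∀ w ∈ rigidWords, ∀ i ∈ w, i = 0 ∨ i = 1 := by decide
  have hρu : (restrict {b, c} u).map ρ = w := by
    rw [hu, List.map_map]
    conv_rhs => rw [← List.map_id w]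
    refine List.map_congr_left fun i hi ↦ ?_
    rcases hwbin w hw i hi with rfl | rfl <;> simp [hρ, hbc.symm]
  refine eq_of_map_eq hρinj (hmem v) (hmem u) ?_
  rw [hρu]
  refine eq_of_subEquiv_rigid w hw _ ?_ ?_
  · have hlen : w.length = ((restrict {b, c} v).map ρ).length := by
      rw [← hρu, List.length_map, List.length_map, hperm.length_eq]
    rw [hlen]
    refine mem_binaryWords fun x hx ↦ ?_
    obtain ⟨z, -, rfl⟩ := List.mem_map.1 hx
    by_cases hz : z = b <;> simp [hρ, hz]
  · have := (h.filter (· ∈ ({b, c} : Finset ℕ))).map ρ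
    rwa [← hρu]

section

variable {Y : List ℕ} (hnd : Y.Nodup) (h0 : 0 ∉ Y) (h1 : 1 ∉ Y)
include hnd h0 h1

/-- The word `x t y₁ ⋯ yₖ x yₖ ⋯ y₁ x` is determined by its subsequences of length at most three
and the number of occurrences of `x`. -/
theorem eq_mirrorWord {v : List ℕ} (h : SubEquiv 3 (mirrorWord Y) v)
    (hc : v.count 0 = (mirrorWord Y).count 0) : v = mirrorWord Y := by
  have hcount : ∀ z, v.count z = (mirrorWord Y).count z := fun z ↦ by
    by_cases hz : z = 0
    · rw [hz, hc]
    · exact h.count_eq_of_lt (Nat.lt_succ_of_le (count_mirrorWord_le hnd h1 hz))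
  have hmem : ∀ z ∈ mirrorWord Y, z = 0 ∨ z = 1 ∨ z ∈ Y := fun z hz ↦ by
    simp only [mirrorWord, List.mem_append, List.mem_cons, List.mem_reverse, List.not_mem_nil,
      or_false] at hz
    tauto
  set A := (mirrorWord Y).toFinset with hA
  have self : ∀ w : List ℕ, (∀ z, w.count z = (mirrorWord Y).count z) → restrict A w = w :=
    fun w hw ↦ by
      rw [restrict, List.filter_eq_self]
      intro z hz
      have := List.count_pos_iff.2 hz
      rw [hw, List.count_pos_iff] at this
      simpa [hA] using this
  rw [← self v hcount]
  conv_rhs => rw [← self (mirrorWord Y) fun _ ↦ rfl]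
  have h01 : restrict {0, 1} v = restrict {0, 1} (mirrorWord Y) := by
    refine restrict_eq_of_rigid h hcount zero_ne_one (w := [0, 1, 0, 0]) (by decide) ?_
    have nil : restrict {0, 1} Y = [] := restrict_eq_nil_of_forall_notMem fun z hz ↦ by
      simp only [Finset.mem_insert, Finset.mem_singleton, not_or]
      exact ⟨fun he ↦ h0 (he ▸ hz), fun he ↦ h1 (he ▸ hz)⟩
    have nil' : restrict {0, 1} Y.reverse = [] := by simpa [restrict] using nil
    simp only [mirrorWord, restrict_append, List.cons_append, List.nil_append,
      restrict_cons_of_mem, Finset.mem_insert, Finset.mem_singleton, true_or, or_true, nil, nil']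
    simp [restrict]
  have single : ∀ y ∈ Y, restrict {y} Y = [y] := fun y hy ↦ by
    rw [restrict_singleton, List.count_eq_one_of_mem hnd hy, List.replicate_one]
  have single' : ∀ y ∈ Y, restrict {y} Y.reverse = [y] := fun y hy ↦ by
    rw [restrict_singleton, List.count_reverse, List.count_eq_one_of_mem hnd hy,
      List.replicate_one]
  have drop : ∀ (y i : ℕ) (w : List ℕ), i ∉ w → restrict {i, y} w = restrict {y} w := by
    intro y i w hi
    refine List.filter_congr fun z hz ↦ ?_
    have : z ≠ i := fun he ↦ hi (he ▸ hz)
    simp [this]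
  have h0y : ∀ y ∈ Y, restrict {0, y} v = restrict {0, y} (mirrorWord Y) := fun y hy ↦ by
    have hy0 : 0 ≠ y := fun he ↦ h0 (he ▸ hy)
    have hy1 : 1 ≠ y := fun he ↦ h1 (he ▸ hy)
    refine restrict_eq_of_rigid h hcount hy0 (w := [0, 1, 0, 1, 0]) (by decide) ?_
    have e1 := single y hy
    have e2 := single' y hy
    rw [← drop y 0 Y h0] at e1
    rw [← drop y 0 Y.reverse (by simpa using h0)] at e2
    have e3 : (1 : ℕ) ∉ ({0, y} : Finset ℕ) := by simp [hy1]
    simp only [mirrorWord, restrict_append, List.cons_append, List.nil_append,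
      restrict_cons_of_notMem e3, restrict_cons_of_mem, Finset.mem_insert, true_or, e1, e2]
    simp [restrict]
  have h1y : ∀ y ∈ Y, restrict {1, y} v = restrict {1, y} (mirrorWord Y) := fun y hy ↦ by
    have hy0 : 0 ≠ y := fun he ↦ h0 (he ▸ hy)
    have hy1 : 1 ≠ y := fun he ↦ h1 (he ▸ hy)
    refine restrict_eq_of_rigid h hcount hy1 (w := [0, 1, 1]) (by decide) ?_
    have e1 := single y hy
    have e2 := single' y hy
    rw [← drop y 1 Y h1] at e1
    rw [← drop y 1 Y.reverse (by simpa using h1)] at e2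
    have e3 : (0 : ℕ) ∉ ({1, y} : Finset ℕ) := by simp [hy0]
    simp only [mirrorWord, restrict_append, List.cons_append, List.nil_append,
      restrict_cons_of_notMem e3, restrict_cons_of_mem, Finset.mem_insert, true_or, e1, e2]
    simp [restrict]
  refine restrict_eq_of_pairs fun y hy z hz ↦ ?_
  by_cases hyz : y = z
  · rw [hyz, Finset.pair_eq_singleton, restrict_singleton, restrict_singleton, hcount]
  rcases hmem y (by simpa [hA] using hy) with rfl | rfl | hy <;>
    rcases hmem z (by simpa [hA] using hz) with rfl | rfl | hz
  · exact absurd rfl hyz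
  · exact h01
  · exact h0y z hz
  · rw [Finset.pair_comm]
    exact h01
  · exact absurd rfl hyz
  · exact h1y z hz
  · rw [Finset.pair_comm]
    exact h0y y hy
  · rw [Finset.pair_comm]
    exact h1y y hy
  · rcases restrict_pair_mirrorWord hnd h0 h1 hy hz hyz with hu | hu
    · exact restrict_eq_of_rigid h hcount hyz (w := [0, 1, 1, 0]) (by decide) (by simp [hu])
    · rw [Finset.pair_comm] at hu ⊢
      exact restrict_eq_of_rigid h hcount (Ne.symm hyz) (w := [0, 1, 1, 0]) (by decide)
        (by simp [hu])

end

/-! ### Isolation of the word under identities with few variables -/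

theorem append_cons_inj_of_notMem {x : ℕ} {p q p' q' : List ℕ} (hp : x ∉ p) (hp' : x ∉ p')
    (h : p ++ x :: q = p' ++ x :: q') : p = p' ∧ q = q' := by
  induction p generalizing p' with
  | nil =>
    cases p' with
    | nil => exact ⟨rfl, (List.cons_eq_cons.1 h).2⟩
    | cons b p' => exact absurd (by simp [(List.cons_eq_cons.1 h).1]) hp'
  | cons a p ih =>
    cases p' with
    | nil => exact absurd (by simp [(List.cons_eq_cons.1 h).1]) hp
    | cons b p' =>
      obtain ⟨hab, htail⟩ := List.cons_eq_cons.1 h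
      rw [List.mem_cons, not_or] at hp hp'
      obtain ⟨hpp, hqq⟩ := ih hp.2 hp'.2 htail
      exact ⟨by rw [hab, hpp], hqq⟩

theorem count_flatMap_filter (θ : ℕ → List ℕ) (c : ℕ) (p : List ℕ) :
    ((p.filter fun z ↦ c ∈ θ z).flatMap θ).count c = (p.flatMap θ).count c := by
  induction p with
  | nil => rfl
  | cons z p ih =>
    by_cases hz : c ∈ θ z
    · simp only [List.filter_cons, hz, decide_true, if_true, List.flatMap_cons,
        List.count_append, ih]
    · simp only [List.filter_cons, hz, decide_false, List.flatMap_cons, List.count_append,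
        List.count_eq_zero.2 hz]
      simpa using ih

theorem length_flatMap_le {θ : ℕ → List ℕ} {p : List ℕ} (h : ∀ z ∈ p, (θ z).length ≤ 1) :
    (p.flatMap θ).length ≤ p.length := by
  induction p with
  | nil => simp
  | cons z p ih =>
    have h1 := h z (by simp)
    have h2 := ih fun y hy ↦ h y (by simp [hy])
    simp only [List.flatMap_cons, List.length_append, List.length_cons]
    omega

section

variable {Y : List ℕ} (hnd : Y.Nodup) (h0 : 0 ∉ Y) (h1 : 1 ∉ Y)
include hnd h0 h1

/-- No word of the form `⋯ b c ⋯ b c ⋯` with `b`, `c` among `y₁, …, yₖ` is a subsequence. -/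
theorem not_sublist_mirrorWord {b c : ℕ} (hb : b ∈ Y) (hc : c ∈ Y) (hbc : b ≠ c) :
    ¬ [b, c, b, c].Sublist (mirrorWord Y) := fun h ↦ by
  have h2 := h.filter (· ∈ ({b, c} : Finset ℕ))
  have h3 : [b, c, b, c].Sublist (restrict {b, c} (mirrorWord Y)) := by
    simpa [restrict] using h2
  rcases restrict_pair_mirrorWord hnd h0 h1 hb hc hbc with hu | hu
  · rw [hu] at h3
    have := h3.eq_of_length rfl
    simp [hbc] at this
  · rw [hu] at h3
    have := h3.eq_of_length rfl
    simp [hbc] at this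

/-- Let the instance `e θ(p) d` of the left side of `p ≈ q` be `x t y₁ ⋯ yₖ x yₖ ⋯ y₁ x`. If the
identity changes the number of occurrences of a variable `z` whose value contains `x`, then
the value of `z` is `x`, and `z` occurs three times in `p`. Its occurrences are separated by
variables occurring once: one with `t` in its value, and, as `p` has fewer than `k` letters, one
whose value contains two adjacent letters of `yₖ ⋯ y₁`. -/
theorem count_eq_of_instance {a t₁ t₂ : ℕ} (h₁ : a ≠ t₁) (h₂ : a ≠ t₂) (h₁₂ : t₁ ≠ t₂)
    {p q : List ℕ} (hs : SubEquiv 3 p q) (hp : PatternIdentity a t₁ t₂ p q)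
    (hlen : p.length < Y.length) {θ : ℕ → List ℕ} {e d : List ℕ}
    (hu : e ++ p.flatMap θ ++ d = mirrorWord Y) {z : ℕ} (hz : 0 ∈ θ z) :
    q.count z = p.count z := by
  by_contra hne
  have hz3 : 3 ≤ p.count z := by
    by_contra hlt
    exact hne (hs.count_eq_of_lt (by omega))
  have hcount : ∀ y c, p.count y * (θ y).count c ≤ (mirrorWord Y).count c := fun y c ↦ by
    rw [← hu, List.count_append, List.count_append]
    have := count_mul_le_count_flatMap y θ c p
    omega
  have hzpos := List.count_pos_iff.2 hz
  have hz0 := hcount z 0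
  rw [count_zero_mirrorWord h0] at hz0
  have hz3' : p.count z = 3 := by nlinarith
  have hz1 : (θ z).count 0 = 1 := by
    rw [hz3'] at hz0
    omega
  have hθz : θ z = [0] := by
    have hall : ∀ c ∈ θ z, c = 0 := fun c hc ↦ by
      by_contra hc0
      have e1 := hcount z c
      have e2 := count_mirrorWord_le hnd h1 hc0
      have e3 := List.count_pos_iff.2 hc
      rw [hz3'] at e1
      omega
    have e1 := List.eq_replicate_iff.2 ⟨rfl, hall⟩
    have e2 : (θ z).length = 1 := by
      rw [← hz1, eq_comm, List.count_eq_length]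
      exact fun c hc ↦ (hall c hc).symm
    rwa [e2] at e1
  obtain ⟨P₀, p₁, hp0, hzP0, c0⟩ := exists_split_first (x := z) (w := p) (by omega)
  obtain ⟨P₁, p₂, hp1, hzP1, c1⟩ := exists_split_first (x := z) (w := p₁) (by omega)
  obtain ⟨P₂, P₃, hp2, hzP2, c2⟩ := exists_split_first (x := z) (w := p₂) (by omega)
  have hzP3 : z ∉ P₃ := List.count_eq_zero.1 (by omega)
  have hpeq : p = P₀ ++ z :: (P₁ ++ z :: (P₂ ++ z :: P₃)) := by rw [hp0, hp1, hp2]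
  have hu' : (e ++ P₀.flatMap θ) ++ 0 :: (P₁.flatMap θ ++ 0 :: (P₂.flatMap θ ++ 0 ::
      (P₃.flatMap θ ++ d))) = mirrorWord Y := by
    rw [← hu, hpeq]
    simp [hθz]
  have hc0 := congrArg (List.count 0) hu'
  rw [count_zero_mirrorWord h0] at hc0
  simp only [List.count_append, List.count_cons_self] at hc0
  have n0 : (0 : ℕ) ∉ e ++ P₀.flatMap θ := List.count_eq_zero.1 (by
    rw [List.count_append]; omega)
  have n1 : (0 : ℕ) ∉ P₁.flatMap θ := List.count_eq_zero.1 (by omega)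
  have n2 : (0 : ℕ) ∉ P₂.flatMap θ := List.count_eq_zero.1 (by omega)
  have hform : mirrorWord Y = [] ++ 0 :: ((1 :: Y) ++ 0 :: (Y.reverse ++ 0 :: [])) := rfl
  rw [hform] at hu'
  obtain ⟨-, hu'⟩ := append_cons_inj_of_notMem n0 (by simp) hu'
  obtain ⟨g1, hu'⟩ := append_cons_inj_of_notMem n1 (by simp [h0]) hu'
  obtain ⟨g2, -⟩ := append_cons_inj_of_notMem n2 (by simpa using h0) hu'
  -- The first separator.
  obtain ⟨r, hrP1, hr⟩ := List.mem_flatMap.1 (show (1 : ℕ) ∈ P₁.flatMap θ by simp [g1])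
  have hr1 : p.count r = 1 := by
    have e1 := hcount r 1
    rw [count_one_mirrorWord h1] at e1
    have e2 := List.count_pos_iff.2 hr
    have e3 : 0 < p.count r := List.count_pos_iff.2 (by simp [hpeq, hrP1])
    nlinarith
  -- The second separator.
  obtain ⟨s, hsP2, hs2⟩ : ∃ s ∈ P₂, 2 ≤ (θ s).length := by
    by_contra hcon
    push Not at hcon
    have e1 := length_flatMap_le (θ := θ) (p := P₂) fun y hy ↦ Nat.le_of_lt_succ (hcon y hy)
    have e2 := congrArg List.length hpeq
    rw [g2, List.length_reverse] at e1
    simp only [List.length_append, List.length_cons] at e2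
    omega
  have hs1 : p.count s = 1 := by
    have hpos : 0 < p.count s := List.count_pos_iff.2 (by simp [hpeq, hsP2])
    by_contra hs1
    have hss : [s, s].Sublist p := by
      have : (List.replicate 2 s).Sublist p := List.replicate_sublist_iff.2 (by omega)
      simpa using this
    obtain ⟨b, c, l, hbc⟩ : ∃ b c l, θ s = b :: c :: l := by
      match h : θ s with
      | [] => simp [h] at hs2
      | [b] => simp [h] at hs2
      | b :: c :: l => exact ⟨b, c, l, rfl⟩
    have hbcY : [b, c].Sublist Y.reverse := by
      rw [← g2]
      have e1 : [s].Sublist P₂ := List.singleton_sublist.2 hsP2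
      have e2 := e1.flatMap θ
      refine List.Sublist.trans ?_ e2
      simp [hbc]
    have hne : b ≠ c := by
      have := (List.nodup_reverse.2 hnd).sublist hbcY
      simpa using this
    have hbY : b ∈ Y := List.mem_reverse.1 (hbcY.mem (by simp))
    have hcY : c ∈ Y := List.mem_reverse.1 (hbcY.mem (by simp))
    refine not_sublist_mirrorWord hnd h0 h1 hbY hcY hne ?_
    have e1 : ([s, s].flatMap θ).Sublist (mirrorWord Y) := by
      rw [← hu]
      exact ((hss.flatMap θ).trans (List.sublist_append_right e _)).trans
        (List.sublist_append_left _ d)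
    refine List.Sublist.trans ?_ e1
    have e2 : [b, c].Sublist (θ s) := by simp [hbc]
    simpa using e2.append e2
  obtain ⟨hzr, hzs, hrs, hres⟩ := restrict_of_two_separators hpeq hzP0 hzP1 hzP2 hzP3 hrP1 hsP2
    hr1 hs1
  exact hne (hp.count_eq_of_spread h₁ h₂ h₁₂ (Or.inr ⟨r, s, hzr, hzs, hrs, hres⟩))

/-- Identities with fewer than `k` letters on the left side do not change the word
`x t y₁ ⋯ yₖ x yₖ ⋯ y₁ x`. -/
theorem instance_eq_mirrorWord {a t₁ t₂ : ℕ} (h₁ : a ≠ t₁) (h₂ : a ≠ t₂) (h₁₂ : t₁ ≠ t₂)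
    {p q : List ℕ} (hs : SubEquiv 3 p q) (hp : PatternIdentity a t₁ t₂ p q)
    (hlen : p.length < Y.length) {θ : ℕ → List ℕ} {e d : List ℕ}
    (hu : e ++ p.flatMap θ ++ d = mirrorWord Y) : e ++ q.flatMap θ ++ d = mirrorWord Y := by
  refine eq_mirrorWord hnd h0 h1 ?_ ?_
  · rw [← hu]
    exact listIdentity_reflRel_iff.1
      (((listIdentity_reflRel_iff.2 hs).flatMap θ).append e d)
  · rw [← hu]
    simp only [List.count_append]
    have hperm : (p.filter fun z ↦ 0 ∈ θ z).Perm (q.filter fun z ↦ 0 ∈ θ z) :=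
      List.perm_iff_count.2 fun z ↦ by
        by_cases hz : 0 ∈ θ z
        · rw [List.count_filter (by simpa using hz), List.count_filter (by simpa using hz),
            count_eq_of_instance hnd h0 h1 h₁ h₂ h₁₂ hs hp hlen hu hz]
        · rw [List.count_eq_zero.2 (by simp [hz]), List.count_eq_zero.2 (by simp [hz])]
    rw [← count_flatMap_filter θ 0 p, ← count_flatMap_filter θ 0 q,
      (hperm.flatMap_right θ).count_eq]

end

theorem not_finitelyBased_prod {a t₁ t₂ : ℕ} (h₁ : a ≠ t₁) (h₂ : a ≠ t₂) (h₁₂ : t₁ ≠ t₂) :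
    ¬ FinitelyBased (ReflRel (Fin 4) ×
      DilworthMonoid ({FreeMonoid.ofList (pattern a t₁ t₂)} : Set (FreeMonoid ℕ))) := by
  rintro ⟨E, hfin, hE, hcomplete⟩
  obtain ⟨k, hk⟩ := (hfin.image fun p ↦ (letters p.1).length + (letters p.2).length).bddAbove
  have hk : ∀ p ∈ E, (letters p.1).length + (letters p.2).length ≤ k := fun p hp ↦
    hk (Set.mem_image_of_mem _ hp)
  set Y := List.range' 2 (k + 1) with hY
  have hnd : Y.Nodup := List.nodup_range'
  have h0 : 0 ∉ Y := by simp [hY, List.mem_range'_1]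
  have h1 : 1 ∉ Y := by simp [hY, List.mem_range'_1]
  have hYlen : Y.length = k + 1 := by simp [hY]
  obtain ⟨U, hU⟩ := exists_letters_eq (l := mirrorWord Y) (by simp [mirrorWord])
  obtain ⟨V, hV⟩ := exists_letters_eq (l := mirrorWord' Y) (by simp [mirrorWord'])
  have hUV : (U, V) ∈ identitiesOf (ReflRel (Fin 4) ×
      DilworthMonoid ({FreeMonoid.ofList (pattern a t₁ t₂)} : Set (FreeMonoid ℕ))) := by
    refine satisfiesIdentity_iff.2 (listIdentity_prod_iff.2 ⟨?_, ?_⟩)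
    · exact listIdentity_reflRel_iff.2 (by rw [hU, hV]; exact subEquiv_mirrorWord Y)
    · rw [hU, hV]
      exact patternIdentity_mirrorWord h₁ h₂ h₁₂ h0
  have hded : Deducible E U V := hcomplete _ hUV
  have key : ∀ x y : Word, ConGen.Rel (fun x y : Word ↦
      ∃ p ∈ E, ∃ θ : Word →ₙ* Word, x = θ p.1 ∧ y = θ p.2) x y →
      ∀ e d, e ++ letters x ++ d = mirrorWord Y ↔ e ++ letters y ++ d = mirrorWord Y := by
    intro x y h
    induction h with
    | of x y h =>
      obtain ⟨p, hp, θ, rfl, rfl⟩ := h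
      have hid := listIdentity_prod_iff.1 (satisfiesIdentity_iff.1 (hE hp))
      have hs : SubEquiv 3 (letters p.1) (letters p.2) := listIdentity_reflRel_iff.1 hid.1
      have hlen := hk p hp
      intro e d
      rw [letters_map, letters_map]
      exact ⟨instance_eq_mirrorWord hnd h0 h1 h₁ h₂ h₁₂ hs hid.2 (by omega),
        instance_eq_mirrorWord hnd h0 h1 h₁ h₂ h₁₂ hs.symm (ListIdentity.symm hid.2) (by omega)⟩
    | refl x => exact fun _ _ ↦ Iff.rfl
    | symm _ ih => exact fun e d ↦ (ih e d).symm
    | trans _ _ ih ih' => exact fun e d ↦ (ih e d).trans (ih' e d)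
    | @mul w x y z _ _ ih ih' =>
      intro e d
      have e1 := ih e (letters y ++ d)
      have e2 := ih' (e ++ letters x) d
      simp only [letters_mul, List.append_assoc] at e1 e2 ⊢
      exact e1.trans e2
  have hres := (key U V hded [] []).1 (by simp [hU])
  have hlen := congrArg List.length hres
  simp [hV, mirrorWord, mirrorWord'] at hlen

theorem mainTheorem10 (a t₁ t₂ : ℕ) (h₁ : a ≠ t₁) (h₂ : a ≠ t₂) (h₁₂ : t₁ ≠ t₂) :
    FinitelyBased (ReflRel (Fin 4)) ∧
    FinitelyBased (DilworthMonoid ({FreeMonoid.ofList [a, t₁, a, t₂, a]} : Set (FreeMonoid ℕ))) ∧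
    ¬ FinitelyBased (ReflRel (Fin 4) ×
      DilworthMonoid ({FreeMonoid.ofList [a, t₁, a, t₂, a]} : Set (FreeMonoid ℕ))) :=
  ⟨finitelyBased_reflRel_four, finitelyBased_pattern h₁ h₂ h₁₂, not_finitelyBased_prod h₁ h₂ h₁₂⟩
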